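/- Let $\mathbb I=\mathbb Q\cap[0,1)$ and let $K(a,b,c)$ be the cyclic order $a<b<c\ \vee\ b<c<a\ \vee\ c<a<b$ on $\mathbb I$. Two tuples in $\mathbb I^V$ ($V$ finite) lie in the same orbit if some bijection of $\mathbb I$ that preserves and reflects $K$ maps one to the other pointwise. A $K$-constraint is a quantifier-free formula over $=$ and $K$. The characteristic $K$-constraint $\varphi^{\mathbb I}_o$ of an orbit $o$ is the conjunction of all atomic formulas $x_i=x_j$, $K(x_i,x_j,x_k)$ and negations of such that hold in a representative of $o$. A register pushdown automaton (RPDA) $\mathcal Q=(\Sigma,\Gamma,L,X,Z,\Delta)$ has finite input alphabet $\Sigma$, stack alphabet $\Gamma$, set of locations $L$, sets $X$ and $Z$ of global and stack registers, and a finite set $\Delta$ of rules $(\ell,\mathsf{op},r)$, where $\mathsf{op}$ is an input $a\in\Sigma\cup\{\varepsilon\}$, a $K$-constraint $\varphi(\vec x,\vec x')$ relating old and new values of the global registers, or $\mathsf{push}(\gamma:\psi(\vec x,\vec z))$ or $\mathsf{pop}(\gamma:\psi(\vec x,\vec z))$ with $\gamma\in\Gamma$ and $\psi$ a $K$-constraint.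 Configurations are triples $(\ell,\mu,w)\in L\times\mathbb I^X\times(\Gamma\times\mathbb I^Z)^*$. Input rules read $a$ and leave $\mu$ and $w$ unchanged; constraint rules leave $w$ unchanged and change $\mu$ to any $\nu$ with $(\mu,\nu)\models\varphi$; push (pop) rules leave $\mu$ unchanged and push (pop) a stack symbol $(\gamma,\mu_1)$ with $(\mu,\mu_1)\models\psi$; all rules other than input rules read $\varepsilon$. Write $\mu\leadsto^{w}_{\ell r}\nu$ if there is a (possibly empty) run from $(\ell,\mu,\varepsilon)$ to $(r,\nu,\varepsilon)$ labelled by $w\in(\Sigma\cup\{\varepsilon\})^*$, and, for $f\in\mathbb N^\Sigma$, $\mu\leadsto^{f}_{\ell r}\nu$ if $\mu\leadsto^{w}_{\ell r}\nu$ for some $w$ in which each $a\in\Sigma$ occurs exactly $f(a)$ times. The size of $\mathcal Q$ is $|\Sigma|+|\Gamma|+|L|+|X|+|Z|$ plus the total size of its rules. Let $X'$ and $X''$ be copies of $X$. The grammar $G$ of $\mathcal Q$ has a nonterminal $X_{\ell r o}$ for all $\ell,r\in L$ and every orbit $o$ of pairs $(\mu,\nu)\in\mathbb I^X\times\mathbb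 I^{X'}$. Call $o$ diagonal if $\mu=\nu$ for its elements $(\mu,\nu)$, and write $o_{ij}$ for the projection of an orbit of triples to its $i$-th and $j$-th components. The productions of $G$ are: - $X_{\ell\ell o}\to\varepsilon$, for $o$ diagonal; - $X_{\ell r o}\to a$, for a rule $(\ell,a,r)$ with $a\in\Sigma\cup\{\varepsilon\}$ and $o$ diagonal; - $X_{\ell r o}\to\varepsilon$, for a rule $(\ell,\varphi,r)$ with $o\models\varphi$; - $X_{\ell r o_{13}}\to X_{\ell m o_{12}}X_{m r o_{23}}$, for $\ell,m,r\in L$ and $o$ an orbit of $\mathbb I^X\times\mathbb I^{X'}\times\mathbb I^{X''}$; - $X_{\ell r o_{12}}\to X_{\ell' r' o_{12}}$, for rules $(\ell,\mathsf{push}(\gamma:\varphi),\ell')$ and $(r',\mathsf{pop}(\gamma:\psi),r)$ and $o$ an orbit of $\mathbb I^X\times\mathbb I^{X'}\times\mathbb I^Z$ with $o_{13}\models\varphi$ and $o_{23}\models\psi$. **Corollary.** There is a polynomial $p$ such that the following holds for every RPDA $\mathcal Q$. 1. For every orbit $o$ of $\mathbb I^X\times\mathbb I^{X'}$, $\varphi^{\mathbb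 I}_o$ is a $K$-constraint satisfied exactly by the elements of $o$. 2. For all $\ell,r,o$, the language $L(X_{\ell r o})$ generated from $X_{\ell r o}$ consists of the words obtained by erasing the $\varepsilon$'s in the words $w$ such that $\mu\leadsto^{w}_{\ell r}\nu$ for some $(\mu,\nu)\in o$. 3. There are existential Presburger formulas $\varphi^{\mathbb Z}_{\ell r o}(\vec f)$ (over $(\mathbb Z,\le,(\equiv_m)_{m\ge1},+,(k)_{k\in\mathbb Z})$, with numbers written in binary), each expressing the Parikh image of $L(X_{\ell r o})$, i.e. satisfied by $f\in\mathbb N^\Sigma$ iff $f$ is the vector of letter counts of some word in $L(X_{\ell r o})$, such that for all $\ell,r\in L$ the formula $$\varphi_{\ell r}(\vec x,\vec f,\vec x')\ \equiv\ \bigvee_{o}\ \varphi^{\mathbb Z}_{\ell r o}(\vec f)\wedge\varphi^{\mathbb I}_o(\vec x,\vec x'),$$ where $o$ ranges over the finitely many orbits of $\mathbb I^X\times\mathbb I^{X'}$, expresses the reachability relation of $\mathcal Q$: for all $\mu,\nu\in\mathbb I^X$ and $f\in\mathbb N^\Sigma$, $(\mu,f,\nu)\models\varphi_{\ell r}$ iff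 $\mu\leadsto^{f}_{\ell r}\nu$. Moreover the size of $\varphi_{\ell r}$ is at most exponential, namely at most $2^{p(|\mathcal Q|)}$, where $|\mathcal Q|$ is the size of $\mathcal Q$. -/

import Mathlib

open FirstOrder FirstOrder.Language

/-! ### Cyclic atoms and their orbits -/

/-- The universe `ℚ ∩ [0, 1)` of the cyclic atoms. -/
abbrev Atom : Type := Set.Ico (0 : ℚ) 1

/-- The ternary cyclic order on `ℚ ∩ [0, 1)`. -/
def CycK (a b c : Atom) : Prop := (a < b ∧ b < c) ∨ (b < c ∧ c < a) ∨ (c < a ∧ a < b)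

/-- Automorphisms of the cyclic atoms: bijections preserving and reflecting `K`. -/
def IsCycAut (α : Equiv.Perm Atom) : Prop :=
  ∀ a b c, CycK a b c ↔ CycK (α a) (α b) (α c)

/-- Two tuples (indexed by `V`) are in the same orbit if an automorphism maps one to the other. -/
def orbitSetoid (V : Type) : Setoid (V → Atom) where
  r u v := ∃ α : Equiv.Perm Atom, IsCycAut α ∧ ∀ i, α (u i) = v i
  iseqv :=
    { refl := fun u => ⟨Equiv.refl _, fun _ _ _ => Iff.rfl, fun _ => rfl⟩
      symm := by
        rintro u v ⟨α, hα, h⟩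
        refine ⟨α.symm, fun a b c => ?_, fun i => by rw [← h i, Equiv.symm_apply_apply]⟩
        rw [hα (α.symm a) (α.symm b) (α.symm c)]
        simp only [Equiv.apply_symm_apply]
      trans := by
        rintro u v w ⟨α, hα, h⟩ ⟨β, hβ, h'⟩
        exact ⟨α.trans β, fun a b c => (hα a b c).trans (hβ _ _ _),
          fun i => by rw [Equiv.trans_apply, h i, h' i]⟩ }

/-- The orbits of `V`-indexed tuples of atoms. -/
abbrev Orbit (V : Type) : Type := Quotient (orbitSetoid V)

/-- The orbit of a tuple. -/
def orbitOf {V : Type} (v : V → Atom) : Orbit V := Quotient.mk (orbitSetoid V) v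

/-- The projection of an orbit to the components selected by `f : W → V`. -/
def Orbit.proj {V W : Type} (f : W → V) : Orbit V → Orbit W :=
  Quotient.map' (fun v => v ∘ f) (by
    rintro u v ⟨α, hα, h⟩
    exact ⟨α, hα, fun i => h (f i)⟩)

/-- Every finite partial order isomorphism of `ℚ` extends to an order automorphism. -/
theorem exists_orderIso_extending (p : Order.PartialIso ℚ ℚ) :
    ∃ e : ℚ ≃o ℚ, ∀ q ∈ p.val, e q.1 = q.2 := by
  let toCofinal : ℚ ⊕ ℚ → Order.Cofinal (Order.PartialIso ℚ ℚ) := fun x =>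
    Sum.recOn x (Order.PartialIso.definedAtLeft ℚ) (Order.PartialIso.definedAtRight ℚ)
  let J : Order.Ideal (Order.PartialIso ℚ ℚ) := Order.idealOfCofinals p toCofinal
  have hp : p ∈ J := Order.mem_idealOfCofinals p toCofinal
  let F := fun a => Order.PartialIso.funOfIdeal a J
    (Order.cofinal_meets_idealOfCofinals _ toCofinal (Sum.inl a))
  let G := fun b => Order.PartialIso.invOfIdeal b J
    (Order.cofinal_meets_idealOfCofinals _ toCofinal (Sum.inr b))
  refine ⟨OrderIso.ofCmpEqCmp (fun a => (F a).val) (fun b => (G b).val) fun a b => ?_, ?_⟩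
  · rcases (F a).prop with ⟨f, hf, ha⟩
    rcases (G b).prop with ⟨g, hg, hb⟩
    rcases J.directed _ hf _ hg with ⟨m, _, fm, gm⟩
    exact m.prop (a, _) (fm ha) (_, b) (gm hb)
  · intro q hq
    rcases (F q.1).prop with ⟨f, hf, ha⟩
    rcases J.directed _ hf _ hp with ⟨m, _, fm, gm⟩
    have h := m.prop (q.1, (F q.1).val) (fm ha) q (gm hq)
    rw [cmp_self_eq_eq] at h
    exact (cmp_eq_eq_iff _ _).1 h.symm

theorem cmp_eq_of_le_iff {a b c d : ℚ} (h : (a ≤ b ↔ c ≤ d) ∧ (b ≤ a ↔ d ≤ c)) :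
    cmp a b = cmp c d := by
  obtain ⟨h₁, h₂⟩ := h
  have h₃ : a < b ↔ c < d := by rw [← not_le, ← not_le, h₂]
  have h₄ : b < a ↔ d < c := by rw [← not_le, ← not_le, h₁]
  simp only [cmp, cmpUsing, h₃, h₄]

/-- Tuples with the same order pattern (including the comparison with `0`) are in one orbit. -/
theorem orbit_of_pattern {V : Type} [Finite V] (u v : V → Atom)
    (h : ∀ i j, u i ≤ u j ↔ v i ≤ v j)
    (h0 : ∀ i, (u i : ℚ) ≤ 0 ↔ (v i : ℚ) ≤ 0) : (orbitSetoid V).r u v := by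
  classical
  have := Fintype.ofFinite V
  have key : ∀ i j, cmp (u i : ℚ) (u j) = cmp (v i : ℚ) (v j) := fun i j =>
    cmp_eq_of_le_iff ⟨h i j, h j i⟩
  have ht : ∀ i j : V ⊕ Bool,
      cmp (Sum.elim (fun i => (u i : ℚ)) (fun b => if b then 1 else 0) i)
          (Sum.elim (fun i => (u i : ℚ)) (fun b => if b then 1 else 0) j) =
      cmp (Sum.elim (fun i => (v i : ℚ)) (fun b => if b then 1 else 0) i)
          (Sum.elim (fun i => (v i : ℚ)) (fun b => if b then 1 else 0) j) := by
    have hu := fun i => (u i).2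
    have hv := fun i => (v i).2
    simp only [Set.mem_Ico] at hu hv
    rintro (i | i) (j | j)
    · exact key i j
    · refine cmp_eq_of_le_iff ?_
      cases j
      · simpa [(hu i).1, (hv i).1] using h0 i
      · simp [(hu i).2.not_ge, (hv i).2.not_ge, (hu i).2.le, (hv i).2.le]
    · refine cmp_eq_of_le_iff ?_
      cases i
      · simpa [(hu j).1, (hv j).1] using h0 j
      · simp [(hu j).2.not_ge, (hv j).2.not_ge, (hu j).2.le, (hv j).2.le]
    · rfl
  let s : V ⊕ Bool → ℚ × ℚ := fun i =>
    (Sum.elim (fun i => (u i : ℚ)) (fun b => if b then 1 else 0) i,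
      Sum.elim (fun i => (v i : ℚ)) (fun b => if b then 1 else 0) i)
  obtain ⟨e, he⟩ := exists_orderIso_extending ⟨Finset.univ.image s, by
    intro p hp q hq
    obtain ⟨i, -, rfl⟩ := Finset.mem_image.1 hp
    obtain ⟨j, -, rfl⟩ := Finset.mem_image.1 hq
    exact ht i j⟩
  have he' : ∀ i, e (s i).1 = (s i).2 := fun i =>
    he _ (Finset.mem_image_of_mem _ (Finset.mem_univ i))
  have e0 : e 0 = 0 := he' (Sum.inr false)
  have e1 : e 1 = 1 := he' (Sum.inr true)
  have hI : ∀ x : ℚ, x ∈ Set.Ico (0 : ℚ) 1 ↔ e x ∈ Set.Ico (0 : ℚ) 1 := by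
    intro x
    have a := e.le_iff_le (x := 0) (y := x)
    have b := e.lt_iff_lt (x := x) (y := 1)
    rw [e0] at a
    rw [e1] at b
    simp only [Set.mem_Ico, a, b]
  refine ⟨e.toEquiv.subtypeEquiv hI, ?_, fun i => Subtype.ext (he' (Sum.inl i))⟩
  have hlt : ∀ a b : Atom, e.toEquiv.subtypeEquiv hI a < e.toEquiv.subtypeEquiv hI b ↔ a < b :=
    fun a b => e.lt_iff_lt (x := a.1) (y := b.1)
  intro a b c
  simp only [CycK, hlt]

instance {V : Type} [Finite V] : Finite (Orbit V) := by
  let P : Orbit V → (V → V → Prop) × (V → Prop) := fun o =>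
    (fun i j => Quotient.out o i ≤ Quotient.out o j, fun i => (Quotient.out o i : ℚ) ≤ 0)
  refine Finite.of_injective P fun o o' h => ?_
  rw [← Quotient.out_eq o, ← Quotient.out_eq o']
  refine Quotient.sound (orbit_of_pattern _ _ (fun i j => ?_) fun i => ?_)
  · exact iff_of_eq (congrFun (congrFun (congrArg Prod.fst h) i) j)
  · exact iff_of_eq (congrFun (congrArg Prod.snd h) i)

/-! ### Sizes of first-order formulas -/

/-- The size of a term; `wF` is the size of a function symbol, a variable has size one. -/
def termSize {L : FirstOrder.Language.{0, 0}} (wF : ∀ n, L.Functions n → ℕ) {α : Type} : L.Term α → ℕ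
  | .var _ => 1
  | .func (l := l) f ts => wF l f + ∑ i, termSize wF (ts i)

/-- The size of a formula; `wF`, `wR` give the sizes of function and relation symbols. -/
def formulaSize {L : FirstOrder.Language.{0, 0}} (wF : ∀ n, L.Functions n → ℕ)
    (wR : ∀ n, L.Relations n → ℕ) {α : Type} : {n : ℕ} → L.BoundedFormula α n → ℕ
  | _, .falsum => 1
  | _, .equal t u => 1 + termSize wF t + termSize wF u
  | _, .rel (l := l) R ts => wR l R + ∑ i, termSize wF (ts i)
  | _, .imp φ ψ => 1 + formulaSize wF wR φ + formulaSize wF wR ψ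
  | _, .all φ => 1 + formulaSize wF wR φ

/-! ### `K`-constraints -/

/-- The only relation symbol of the language of cyclic atoms. -/
inductive CycRel : ℕ → Type
  | K : CycRel 3

/-- The first-order language of the cyclic atoms (with equality). -/
def cycLang : FirstOrder.Language.{0, 0} := ⟨fun _ => Empty, CycRel⟩

/-- The symbol `K` as a relation symbol of the language. -/
def cycSymK : cycLang.Relations 3 := CycRel.K

instance : cycLang.Structure Atom where
  funMap := fun f => nomatch f
  RelMap := fun {_} R =>
    match R with
    | CycRel.K => fun v => CycK (v 0) (v 1) (v 2)

/-- A `K`-constraint: a quantifier-free formula over equality and `K`. -/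
def KConstraint (V : Type) : Type :=
  {φ : cycLang.Formula V // BoundedFormula.IsQF φ}

/-- The size of a formula over cyclic atoms. -/
def cycSize {V : Type} (φ : cycLang.Formula V) : ℕ :=
  formulaSize (fun _ _ => 1) (fun _ _ => 1) φ

/-- The `K`-constraint `φ` holds in (the tuples of) the orbit `o`. -/
def Orbit.Sat {V : Type} (o : Orbit V) (φ : KConstraint V) : Prop :=
  ∃ v, orbitOf v = o ∧ φ.1.Realize v

open Classical in
/-- The characteristic `K`-constraint of an orbit: the conjunction of all the atomic formulas over
equality and `K`, or negations of such, that hold in a representative of the orbit. -/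
noncomputable def charConstraint {V : Type} [Finite V] (o : Orbit V) : cycLang.Formula V :=
  let a : V → Atom := Quotient.out o
  let eq (i j : V) : cycLang.Formula V := Term.equal (Term.var i) (Term.var j)
  let rel (i j k : V) : cycLang.Formula V :=
    cycSymK.formula ![Term.var i, Term.var j, Term.var k]
  Formula.iInf (fun p : V × V => if a p.1 = a p.2 then eq p.1 p.2 else ∼(eq p.1 p.2)) ⊓
  Formula.iInf (fun p : V × V × V =>
    if CycK (a p.1) (a p.2.1) (a p.2.2) then rel p.1 p.2.1 p.2.2 else ∼(rel p.1 p.2.1 p.2.2))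

/-! ### Presburger formulas -/

/-- Function symbols of Presburger arithmetic: all integer constants, and addition. -/
inductive PresFunc : ℕ → Type
  | const (k : ℤ) : PresFunc 0
  | add : PresFunc 2

/-- Relation symbols of Presburger arithmetic: the order and the congruences. -/
inductive PresRel : ℕ → Type
  | le : PresRel 2
  | modEq (m : ℕ+) : PresRel 2

/-- The language of Presburger arithmetic `(ℤ, ≤, (≡ₘ)ₘ, +, (k)ₖ)`. -/
def presLang : FirstOrder.Language.{0, 0} := ⟨PresFunc, PresRel⟩

instance : presLang.Structure ℤ where
  funMap := fun {_} f =>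
    match f with
    | PresFunc.const k => fun _ => k
    | PresFunc.add => fun v => v 0 + v 1
  RelMap := fun {_} R =>
    match R with
    | PresRel.le => fun v => v 0 ≤ v 1
    | PresRel.modEq m => fun v => v 0 ≡ v 1 [ZMOD (m : ℕ)]

/-- Size of function symbols; constants are encoded in binary. -/
def presFuncSize : ∀ n, presLang.Functions n → ℕ
  | _, PresFunc.const k => 1 + k.natAbs.size
  | _, PresFunc.add => 1

/-- Size of relation symbols; moduli are encoded in binary. -/
def presRelSize : ∀ n, presLang.Relations n → ℕ
  | _, PresRel.le => 1
  | _, PresRel.modEq m => 1 + (m : ℕ).size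

/-- The size of a Presburger formula. -/
def presSize {V : Type} (φ : presLang.Formula V) : ℕ := formulaSize presFuncSize presRelSize φ

/-! ### Two-sorted formulas -/

/-- Positive boolean combinations of Presburger formulas with integer variables in `A` and
formulas over the cyclic atoms with variables in `V`. -/
inductive HybridFormula (A V : Type) : Type
  | int (φ : presLang.Formula A)
  | cyc (φ : cycLang.Formula V)
  | bot
  | or (φ ψ : HybridFormula A V)
  | and (φ ψ : HybridFormula A V)

/-- Satisfaction of a two-sorted formula. -/
def HybridFormula.Realize {A V : Type} (f : A → ℤ) (v : V → Atom) : HybridFormula A V → Prop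
  | .int φ => φ.Realize f
  | .cyc φ => φ.Realize v
  | .bot => False
  | .or φ ψ => φ.Realize f v ∨ ψ.Realize f v
  | .and φ ψ => φ.Realize f v ∧ ψ.Realize f v

/-- The size of a two-sorted formula. -/
def HybridFormula.size {A V : Type} : HybridFormula A V → ℕ
  | .int φ => presSize φ
  | .cyc φ => cycSize φ
  | .bot => 1
  | .or φ ψ => 1 + φ.size + ψ.size
  | .and φ ψ => 1 + φ.size + ψ.size

/-- The disjunction of a finite family of two-sorted formulas. -/
noncomputable def HybridFormula.iOr {A V β : Type} [Finite β] (F : β → HybridFormula A V) :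
    HybridFormula A V :=
  let _ := Fintype.ofFinite β
  ((Finset.univ : Finset β).toList.map F).foldr HybridFormula.or HybridFormula.bot

/-! ### Register pushdown automata -/

/-- Operations of a register pushdown automaton with input alphabet `A`, stack alphabet `Γ`, global
registers `X` and stack registers `Z`.  In a test, `Sum.inl x` is the pre-value and `Sum.inr x` the
post-value of the register `x`. -/
inductive Op (A Γ X Z : Type) : Type
  | input (a : Option A)
  | test (φ : KConstraint (X ⊕ X))
  | push (γ : Γ) (ψ : KConstraint (X ⊕ Z))
  | pop (γ : Γ) (ψ : KConstraint (X ⊕ Z))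

/-- The size of an operation. -/
def Op.size {A Γ X Z : Type} : Op A Γ X Z → ℕ
  | .input _ => 1
  | .test φ => 1 + cycSize φ.1
  | .push _ ψ => 1 + cycSize ψ.1
  | .pop _ ψ => 1 + cycSize ψ.1

/-- Register pushdown automata over cyclic atoms with control locations `L`. -/
structure RPDA (A Γ L X Z : Type) where
  /-- The finite set of transition rules. -/
  Δ : Finset (L × Op A Γ X Z × L)

namespace RPDA

variable {A Γ L X Z : Type}

/-- The size of an automaton. -/
def size [Fintype A] [Fintype Γ] [Fintype L] [Fintype X] [Fintype Z] (Q : RPDA A Γ L X Z) : ℕ :=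
  Fintype.card A + Fintype.card Γ + Fintype.card L + Fintype.card X + Fintype.card Z +
    ∑ t ∈ Q.Δ, (1 + t.2.1.size)

/-- Configurations: control location, valuation of the global registers, stack content.
The head of the list is the top of the stack. -/
abbrev Config (Γ L X Z : Type) : Type := L × (X → Atom) × List (Γ × (Z → Atom))

/-- One-step transitions, labelled by an input letter or `ε`. -/
inductive Step (Q : RPDA A Γ L X Z) : Config Γ L X Z → Option A → Config Γ L X Z → Prop
  | input {l r : L} {a : Option A} (μ : X → Atom) (u : List (Γ × (Z → Atom)))
      (h : (l, Op.input a, r) ∈ Q.Δ) : Step Q (l, μ, u) a (r, μ, u)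
  | test {l r : L} {φ : KConstraint (X ⊕ X)} (μ ν : X → Atom) (u : List (Γ × (Z → Atom)))
      (h : (l, Op.test φ, r) ∈ Q.Δ) (hφ : φ.1.Realize (Sum.elim μ ν)) :
      Step Q (l, μ, u) none (r, ν, u)
  | push {l r : L} {γ : Γ} {ψ : KConstraint (X ⊕ Z)} (μ : X → Atom) (μ₁ : Z → Atom)
      (u : List (Γ × (Z → Atom)))
      (h : (l, Op.push γ ψ, r) ∈ Q.Δ) (hψ : ψ.1.Realize (Sum.elim μ μ₁)) :
      Step Q (l, μ, u) none (r, μ, (γ, μ₁) :: u)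
  | pop {l r : L} {γ : Γ} {ψ : KConstraint (X ⊕ Z)} (μ : X → Atom) (μ₁ : Z → Atom)
      (u : List (Γ × (Z → Atom)))
      (h : (l, Op.pop γ ψ, r) ∈ Q.Δ) (hψ : ψ.1.Realize (Sum.elim μ μ₁)) :
      Step Q (l, μ, (γ, μ₁) :: u) none (r, μ, u)

/-- Runs over words in `(A ∪ {ε})*`. -/
inductive Run (Q : RPDA A Γ L X Z) : Config Γ L X Z → List (Option A) → Config Γ L X Z → Prop
  | nil (c : Config Γ L X Z) : Run Q c [] c
  | cons {c c' c'' : Config Γ L X Z} {a : Option A} {w : List (Option A)}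
      (h : Step Q c a c') (hr : Run Q c' w c'') : Run Q c (a :: w) c''

/-- Reachability along the word `w`, from empty stack to empty stack. -/
def ReachWord (Q : RPDA A Γ L X Z) (l r : L) (μ : X → Atom) (w : List (Option A))
    (ν : X → Atom) : Prop :=
  Q.Run (l, μ, []) w (r, ν, [])

open Classical in
/-- The Parikh image (letter counts) of a word. -/
noncomputable def parikh (w : List A) : A → ℕ := fun a => w.count a

/-- The ternary reachability relation; `List.reduceOption` erases the `ε`'s. -/
def Reach (Q : RPDA A Γ L X Z) (l r : L) (μ : X → Atom) (f : A → ℕ) (ν : X → Atom) : Prop :=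
  ∃ w : List (Option A), Q.ReachWord l r μ w ν ∧ f = parikh w.reduceOption

/-! ### The context-free grammar -/

/-- Nonterminals `X_{l r o}`. -/
abbrev NT (L X : Type) : Type := L × L × Orbit (X ⊕ X)

/-- `o` consists of pairs `(μ, ν)` with `μ = ν`. -/
def Diagonal (o : Orbit (X ⊕ X)) : Prop := ∃ μ : X → Atom, orbitOf (Sum.elim μ μ) = o

/-- The productions of the grammar.  Orbits of triples are indexed by left-nested sums, and the
projections `o₁₂`, `o₁₃`, `o₂₃` are written out. -/
inductive Production (Q : RPDA A Γ L X Z) : NT L X → List (Symbol A (NT L X)) → Prop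
  | empty (l : L) {o : Orbit (X ⊕ X)} (ho : Diagonal o) : Production Q (l, l, o) []
  | input {l r : L} {a : Option A} {o : Orbit (X ⊕ X)}
      (h : (l, Op.input a, r) ∈ Q.Δ) (ho : Diagonal o) :
      Production Q (l, r, o) (a.toList.map Symbol.terminal)
  | test {l r : L} {φ : KConstraint (X ⊕ X)} {o : Orbit (X ⊕ X)}
      (h : (l, Op.test φ, r) ∈ Q.Δ) (ho : o.Sat φ) : Production Q (l, r, o) []
  | trans (l m r : L) (o : Orbit ((X ⊕ X) ⊕ X)) :
      Production Q (l, r, o.proj (Sum.map Sum.inl id))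
        [Symbol.nonterminal (l, m, o.proj Sum.inl),
          Symbol.nonterminal (m, r, o.proj (Sum.map Sum.inr id))]
  | pushPop {l l' r' r : L} {γ : Γ} {φ ψ : KConstraint (X ⊕ Z)} (o : Orbit ((X ⊕ X) ⊕ Z))
      (h : (l, Op.push γ φ, l') ∈ Q.Δ) (h' : (r', Op.pop γ ψ, r) ∈ Q.Δ)
      (ho : (o.proj (Sum.map Sum.inl id)).Sat φ) (ho' : (o.proj (Sum.map Sum.inr id)).Sat ψ) :
      Production Q (l, r, o.proj Sum.inl) [Symbol.nonterminal (l', r', o.proj Sum.inl)]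

theorem finite_productions [Finite A] [Finite L] [Finite X] (Q : RPDA A Γ L X Z) :
    {p : ContextFreeRule A (NT L X) | Q.Production p.input p.output}.Finite := by
  have : Finite (Symbol A (NT L X)) := by
    have := Fintype.ofFinite A
    have := Fintype.ofFinite (NT L X)
    infer_instance
  refine Set.Finite.of_finite_image (f := fun p => (p.input, p.output)) ?_ ?_
  · refine ((Set.finite_univ (α := NT L X)).prod
      (List.finite_length_le (Symbol A (NT L X)) 2)).subset ?_
    rintro _ ⟨⟨i, w⟩, h, rfl⟩
    refine ⟨trivial, ?_⟩
    change Q.Production i w at h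
    change w.length ≤ 2
    cases h with
    | @input l r a o h ho => cases a <;> simp
    | _ => simp
  · intro p _ q _ h
    exact ContextFreeRule.ext (congrArg Prod.fst h) (congrArg Prod.snd h)

/-- The grammar of the automaton, with start symbol `X_{l r o}`. -/
noncomputable def grammar [Finite A] [Finite L] [Finite X] (Q : RPDA A Γ L X Z)
    (l r : L) (o : Orbit (X ⊕ X)) : ContextFreeGrammar A where
  NT := NT L X
  initial := (l, r, o)
  rules := Q.finite_productions.toFinset

/-- The disjunction over all orbits `o` of the conjunctions of `φZ o` and the characteristic
constraint of `o`. -/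
noncomputable def reachFormula [Finite X] (φZ : Orbit (X ⊕ X) → presLang.Formula A) :
    HybridFormula A (X ⊕ X) :=
  HybridFormula.iOr fun o : Orbit (X ⊕ X) =>
    HybridFormula.and (HybridFormula.int (φZ o)) (HybridFormula.cyc (charConstraint o))

end RPDA

/-! Everything rests on the homogeneity of the cyclic atoms. Rotating a chosen atom to `0` is an
automorphism, and once `0` is fixed `K` determines the linear order, so the back-and-forth argument
for `ℚ` shows that tuples with the same atomic type share an orbit (`orbitOf_eq_of_cycK_iff`). Hence
characteristic constraints define orbits (`realize_charConstraint`). Runs are carried to runs by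
automorphisms, so reachability depends only on the orbit of the pair of valuations
(`ReachWord.congr`).

The grammar is therefore exact. Soundness: the words of runs are closed under the productions, since
a representative of an orbit of triples supplies valuations at which separately obtained runs can be
glued or bracketed (`RunWord.of_production`). Completeness: a run that empties a given stack splits
into balanced segments separated by the pops of that stack, by induction on the run
(`Run.generatesFrom`).

The Parikh image of any context-free grammar is described by the number of uses of each rule. Such
numbers come from a derivation iff the symbol counts balance and every used rule is reachable from
the start symbol (`exists_parikh_iff`). The hard direction spends the rules one at a time, choosing
each so that the remaining ones stay reachable (`exists_connected_step`). Reachability is witnessed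
by a distance function, so all this is an existential Presburger formula of size quadratic in the
grammar when right-hand sides have length at most two.

There are at most exponentially many orbits, hence nonterminals, rules and disjuncts, which gives
the exponential size bound. -/

/-! ### Homogeneity of the cyclic atoms -/

/-- The rotation of the atoms which takes `a` to `0`. -/
def atomRotation (a : Atom) : Equiv.Perm Atom where
  toFun x := if h : (a : ℚ) ≤ x
    then ⟨x - a, by have := x.2; have := a.2; simp only [Set.mem_Ico] at *; constructor <;> linarith⟩
    else ⟨x - a + 1, by
      have := x.2; have := a.2; simp only [Set.mem_Ico] at *; constructor <;> linarith⟩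
  invFun x := if h : (x : ℚ) + a < 1
    then ⟨x + a, by have := x.2; have := a.2; simp only [Set.mem_Ico] at *; constructor <;> linarith⟩
    else ⟨x + a - 1, by
      have := x.2; have := a.2; simp only [Set.mem_Ico] at *; constructor <;> linarith⟩
  left_inv x := by
    have hx := x.2
    have ha := a.2
    simp only [Set.mem_Ico] at hx ha
    ext
    by_cases h : (a : ℚ) ≤ x
    · simp [h, hx.2]
    · have h' : ¬ ((x : ℚ) - a + 1 + a < 1) := by linarith
      simp only [h, h', dite_false]
      ring
  right_inv x := by
    have hx := x.2
    have ha := a.2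
    simp only [Set.mem_Ico] at hx ha
    ext
    by_cases h : (x : ℚ) + a < 1
    · simp [h, hx.1]
    · have h' : ¬ ((a : ℚ) ≤ x + a - 1) := by linarith
      simp only [h, h', dite_false]
      ring

theorem coe_atomRotation (a x : Atom) :
    (atomRotation a x : ℚ) = if (a : ℚ) ≤ x then (x : ℚ) - a else x - a + 1 := by
  simp only [atomRotation, Equiv.coe_fn_mk]
  split_ifs <;> rfl

theorem isCycAut_atomRotation (a : Atom) : IsCycAut (atomRotation a) := by
  intro x y z
  have hx := x.2
  have hy := y.2
  have hz := z.2
  have ha := a.2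
  simp only [Set.mem_Ico] at hx hy hz ha
  simp only [CycK, ← Subtype.coe_lt_coe, coe_atomRotation]
  -- A rotation only permutes the three disjuncts of `K`; which one holds afterwards depends on
  -- which of the points lie below `a`.
  constructor <;> rintro (⟨h, h'⟩ | ⟨h, h'⟩ | ⟨h, h'⟩) <;> split_ifs at * <;>
    first
    | (left; constructor <;> linarith)
    | (right; left; constructor <;> linarith)
    | (right; right; constructor <;> linarith)

theorem atomRotation_self (a : Atom) : (atomRotation a a : ℚ) = 0 := by
  simp [coe_atomRotation]

/-- Cutting the circle at its least element turns the cyclic order into the linear one. This reduces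
cyclic homogeneity to that of `ℚ`. -/
theorem Atom.le_iff_cycK {o x y : Atom} (ho : (o : ℚ) = 0) :
    x ≤ y ↔ x = y ∨ x = o ∨ CycK o x y := by
  have hx := x.2.1
  have hy := y.2.1
  simp only [CycK, ← Subtype.coe_lt_coe, ← Subtype.coe_le_coe, Subtype.ext_iff, ho]
  constructor
  · intro h
    rcases h.eq_or_lt with h | h
    · exact .inl h
    rcases hx.eq_or_lt with h' | h'
    · exact .inr (.inl h'.symm)
    · exact .inr (.inr (.inl ⟨h', h⟩))
  · rintro (h | h | ⟨_, h⟩ | ⟨h, _⟩ | ⟨h, _⟩) <;> linarith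

theorem orbitOf_eq_iff {V : Type} {u v : V → Atom} :
    orbitOf u = orbitOf v ↔ ∃ α : Equiv.Perm Atom, IsCycAut α ∧ ∀ i, α (u i) = v i :=
  Quotient.eq (r := orbitSetoid V)

theorem orbitOf_comp_aut {V : Type} (u : V → Atom) {α : Equiv.Perm Atom} (hα : IsCycAut α) :
    orbitOf (fun i => α (u i)) = orbitOf u :=
  (orbitOf_eq_iff.2 ⟨α, hα, fun _ => rfl⟩).symm

/-- Tuples which satisfy the same atomic formulas are in the same orbit. -/
theorem orbitOf_eq_of_cycK_iff {V : Type} [Finite V] (u v : V → Atom)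
    (heq : ∀ i j, u i = u j ↔ v i = v j)
    (hK : ∀ i j k, CycK (u i) (u j) (u k) ↔ CycK (v i) (v j) (v k)) :
    orbitOf u = orbitOf v := by
  rcases isEmpty_or_nonempty V with hV | ⟨⟨i₀⟩⟩
  · exact congrArg _ (funext hV.elim)
  -- Both tuples are rotated so that their entries at `i₀` become `0`. Comparison with `0` then
  -- becomes equality with the entry at `i₀`, which is an atomic formula.
  set α := atomRotation (u i₀)
  set β := atomRotation (v i₀)
  have hα : IsCycAut α := isCycAut_atomRotation _
  have hβ : IsCycAut β := isCycAut_atomRotation _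
  have hα₀ : (α (u i₀) : ℚ) = 0 := atomRotation_self _
  have hβ₀ : (β (v i₀) : ℚ) = 0 := atomRotation_self _
  rw [← orbitOf_comp_aut u hα, ← orbitOf_comp_aut v hβ]
  refine Quotient.sound (orbit_of_pattern _ _ (fun i j => ?_) fun i => ?_)
  · rw [Atom.le_iff_cycK hα₀, Atom.le_iff_cycK hβ₀, ← hα, ← hβ, hK]
    simp only [α.injective.eq_iff, β.injective.eq_iff, heq]
  · have h₁ : (α (u i) : ℚ) ≤ 0 ↔ u i = u i₀ := by
      rw [← α.injective.eq_iff, Subtype.ext_iff, hα₀]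
      exact ⟨fun h => le_antisymm h (α (u i)).2.1, fun h => h.le⟩
    have h₂ : (β (v i) : ℚ) ≤ 0 ↔ v i = v i₀ := by
      rw [← β.injective.eq_iff, Subtype.ext_iff, hβ₀]
      exact ⟨fun h => le_antisymm h (β (v i)).2.1, fun h => h.le⟩
    rw [h₁, h₂, heq]

/-- A representative's order pattern, together with the set of its zero entries, determines the
orbit: one bit per pair of indices and one per index. -/
theorem card_orbit_le (V : Type) [Finite V] :
    Nat.card (Orbit V) ≤ 2 ^ (Nat.card V ^ 2 + Nat.card V) := by
  have := Fintype.ofFinite V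
  let P : Orbit V → (V → V → Prop) × (V → Prop) := fun o =>
    (fun i j => Quotient.out o i ≤ Quotient.out o j, fun i => (Quotient.out o i : ℚ) ≤ 0)
  have hP : P.Injective := by
    intro o o' h
    rw [← Quotient.out_eq o, ← Quotient.out_eq o']
    refine Quotient.sound (orbit_of_pattern _ _ (fun i j => ?_) fun i => ?_)
    · exact iff_of_eq (congrFun (congrFun (congrArg Prod.fst h) i) j)
    · exact iff_of_eq (congrFun (congrArg Prod.snd h) i)
  refine (Nat.card_le_card_of_injective P hP).trans (le_of_eq ?_)
  simp only [Nat.card_prod, Nat.card_fun, Nat.card_eq_fintype_card (α := Prop), Fintype.card_prop]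
  rw [← pow_mul, ← pow_add, sq]

/-! ### Realization of `K`-constraints -/

theorem cycLang_realize_aut {V : Type} {φ : cycLang.Formula V} (h : BoundedFormula.IsQF φ)
    {α : Equiv.Perm Atom} (hα : IsCycAut α) (v : V → Atom) :
    φ.Realize (fun i => α (v i)) ↔ φ.Realize v := by
  -- Without function symbols every term is a free variable, so terms commute with `α`; the
  -- valuations of the bound variables are empty and may differ syntactically.
  have ht : ∀ (t : cycLang.Term (V ⊕ Fin 0)) (xs ys : Fin 0 → Atom),
      t.realize (Sum.elim (fun i => α (v i)) xs) = α (t.realize (Sum.elim v ys)) := by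
    rintro ((i | i) | f) xs ys
    · rfl
    · exact i.elim0
    · rename_i f _
      exact nomatch f
  unfold Formula.Realize
  induction h with
  | falsum => rfl
  | of_isAtomic h =>
    cases h with
    | equal t s =>
      simp only [BoundedFormula.realize_bdEqual, ht _ default default, α.injective.eq_iff]
    | rel R ts =>
      simp only [BoundedFormula.realize_rel, ht _ default default]
      cases R
      exact (hα _ _ _).symm
  | imp _ _ h₁ h₂ => simp only [BoundedFormula.realize_imp, h₁, h₂]

theorem KConstraint.realize_congr {V : Type} (φ : KConstraint V) {u v : V → Atom}
    (h : orbitOf u = orbitOf v) : φ.1.Realize u ↔ φ.1.Realize v := by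
  obtain ⟨α, hα, hv⟩ := orbitOf_eq_iff.1 h
  rw [← funext hv]
  exact (cycLang_realize_aut φ.2 hα u).symm

/-- By invariance under automorphisms, one satisfying representative is as good as any other. -/
theorem Orbit.sat_orbitOf {V : Type} {v : V → Atom} {φ : KConstraint V} :
    (orbitOf v).Sat φ ↔ φ.1.Realize v :=
  ⟨fun ⟨_, hu, h⟩ => (φ.realize_congr hu).1 h, fun h => ⟨v, rfl, h⟩⟩

/-! ### Characteristic constraints -/

theorem isQF_iInf {L : FirstOrder.Language.{0, 0}} {α β : Type} [Finite β] {n : ℕ}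
    {f : β → L.BoundedFormula α n} (h : ∀ b, (f b).IsQF) : (BoundedFormula.iInf f).IsQF := by
  simp only [BoundedFormula.iInf]
  let _ := Fintype.ofFinite β
  generalize (Finset.univ : Finset β).toList = l
  induction l with
  | nil => exact BoundedFormula.IsQF.top
  | cons b l ih => exact (h b).inf ih

theorem isQF_charConstraint {V : Type} [Finite V] (o : Orbit V) :
    BoundedFormula.IsQF (charConstraint o) := by
  refine (isQF_iInf fun p => ?_).inf (isQF_iInf fun p => ?_)
  · split_ifs
    · exact (BoundedFormula.IsAtomic.equal _ _).isQF
    · exact (BoundedFormula.IsAtomic.equal _ _).isQF.not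
  · split_ifs
    · exact (BoundedFormula.IsAtomic.rel _ _).isQF
    · exact (BoundedFormula.IsAtomic.rel _ _).isQF.not

theorem realize_cycSymK {V : Type} (v : V → Atom) (i j k : V) :
    (cycSymK.formula ![Term.var i, Term.var j, Term.var k]).Realize v ↔
      CycK (v i) (v j) (v k) := by
  rw [Formula.realize_rel]
  rfl

/-- The constraint says that `v` has the atomic type of the representative. Homogeneity turns this
into equality of orbits; conversely, automorphisms preserve atomic types. -/
theorem realize_charConstraint {V : Type} [Finite V] (o : Orbit V) (v : V → Atom) :
    (charConstraint o).Realize v ↔ orbitOf v = o := by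
  have h : (charConstraint o).Realize v ↔
      (∀ i j, Quotient.out o i = Quotient.out o j ↔ v i = v j) ∧
      ∀ i j k, CycK (Quotient.out o i) (Quotient.out o j) (Quotient.out o k) ↔
        CycK (v i) (v j) (v k) := by
    unfold charConstraint
    simp only [Formula.realize_inf, Formula.realize_iInf, Prod.forall]
    refine and_congr (forall₂_congr fun i j => ?_) (forall₃_congr fun i j k => ?_)
    · split_ifs with h
      · simp [Formula.realize_equal, h]
      · simp [Formula.realize_not, Formula.realize_equal, h]
    · split_ifs with h
      · simp only [realize_cycSymK, h, true_iff]
      · simp only [Formula.realize_not, realize_cycSymK, h, false_iff]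
  have ho : orbitOf (Quotient.out o) = o := Quotient.out_eq o
  rw [h]
  constructor
  · rintro ⟨h₁, h₂⟩
    rw [← ho]
    exact (orbitOf_eq_of_cycK_iff _ _ h₁ h₂).symm
  · intro hv
    obtain ⟨α, hα, hαv⟩ := orbitOf_eq_iff.1 (ho.trans hv.symm)
    simp only [← hαv, α.injective.eq_iff, ← hα _ _ _, implies_true, and_self]

/-! ### Size bounds -/

section Size
variable {L : FirstOrder.Language.{0, 0}} (wF : ∀ n, L.Functions n → ℕ)
  (wR : ∀ n, L.Relations n → ℕ) {α : Type} {n : ℕ}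

/-- The additive constants here and below come from the encoding of connectives by `falsum`, `imp`
and `all`: negation costs 2, conjunction 5, disjunction 3, and each existential quantifier 5. -/
theorem formulaSize_not (φ : L.BoundedFormula α n) :
    formulaSize wF wR φ.not = formulaSize wF wR φ + 2 := by
  simp only [formulaSize]
  omega

theorem formulaSize_top : formulaSize wF wR (⊤ : L.BoundedFormula α n) = 3 := by
  simp only [Top.top, formulaSize_not]
  rfl

theorem formulaSize_inf (φ ψ : L.BoundedFormula α n) :
    formulaSize wF wR (φ ⊓ ψ) = formulaSize wF wR φ + formulaSize wF wR ψ + 5 := by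
  simp only [min, formulaSize_not, formulaSize]
  omega

theorem formulaSize_sup (φ ψ : L.BoundedFormula α n) :
    formulaSize wF wR (φ ⊔ ψ) = formulaSize wF wR φ + formulaSize wF wR ψ + 3 := by
  simp only [max, formulaSize]
  omega

theorem formulaSize_iInf_le {β : Type} [Finite β] {f : β → L.BoundedFormula α n} {B : ℕ}
    (h : ∀ b, formulaSize wF wR (f b) ≤ B) :
    formulaSize wF wR (BoundedFormula.iInf f) ≤ Nat.card β * (B + 5) + 3 := by
  simp only [BoundedFormula.iInf]
  let _ := Fintype.ofFinite β
  rw [Nat.card_eq_fintype_card, ← Finset.card_univ, ← Finset.length_toList]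
  generalize (Finset.univ : Finset β).toList = l
  induction l with
  | nil => simp [formulaSize_top]
  | cons b l ih =>
    simp only [List.map_cons, List.foldr_cons, formulaSize_inf, List.length_cons]
    have := h b
    linarith

theorem formulaSize_iSup_le {β : Type} [Finite β] {f : β → L.BoundedFormula α n} {B : ℕ}
    (h : ∀ b, formulaSize wF wR (f b) ≤ B) :
    formulaSize wF wR (BoundedFormula.iSup f) ≤ Nat.card β * (B + 3) + 1 := by
  simp only [BoundedFormula.iSup]
  let _ := Fintype.ofFinite β
  rw [Nat.card_eq_fintype_card, ← Finset.card_univ, ← Finset.length_toList]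
  generalize (Finset.univ : Finset β).toList = l
  induction l with
  | nil => simp [formulaSize, Bot.bot]
  | cons b l ih =>
    simp only [List.map_cons, List.foldr_cons, formulaSize_sup, List.length_cons]
    have := h b
    linarith

theorem formulaSize_exs (φ : L.BoundedFormula α n) :
    formulaSize wF wR φ.exs = formulaSize wF wR φ + 5 * n := by
  induction n with
  | zero => rfl
  | succ n ih =>
    rw [BoundedFormula.exs, ih, BoundedFormula.ex, formulaSize_not, formulaSize, formulaSize_not]
    omega

end Size

theorem cycSize_charConstraint_le {V : Type} [Finite V] (o : Orbit V) :
    cycSize (charConstraint o) ≤ 11 * (Nat.card V ^ 2 + Nat.card V ^ 3) + 11 := by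
  -- The bound 6 is the size of a negated `K`-atom, the largest of the literals.
  have h₁ := fun f => formulaSize_iInf_le (L := cycLang) (fun _ _ => 1) (fun _ _ => 1) (α := V)
    (n := 0) (β := V × V) (f := f) (B := 6)
  have h₂ := fun f => formulaSize_iInf_le (L := cycLang) (fun _ _ => 1) (fun _ _ => 1) (α := V)
    (n := 0) (β := V × V × V) (f := f) (B := 6)
  unfold cycSize charConstraint
  simp only [Formula.iInf]
  rw [formulaSize_inf]
  refine (Nat.add_le_add_right (Nat.add_le_add (h₁ _ fun p => ?_) (h₂ _ fun p => ?_)) 5).trans ?_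
  · split_ifs
    · exact (by decide : (3 : ℕ) ≤ 6)
    · refine (formulaSize_not _ _ _).trans_le ?_
      exact (by decide : (5 : ℕ) ≤ 6)
  · split_ifs
    · simp [Relations.formula, Relations.boundedFormula, formulaSize, Fin.sum_univ_three,
        Term.relabel, termSize]
    · refine (formulaSize_not _ _ _).trans_le ?_
      simp [Relations.formula, Relations.boundedFormula, formulaSize, Fin.sum_univ_three,
        Term.relabel, termSize]
  · simp only [Nat.card_prod]
    apply le_of_eq
    ring

namespace ContextFreeGrammar

/-! ### Languages and predicates closed under the rules -/

section Closed
variable {T N : Type}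

/-- A list of symbols yields a word if the word is the concatenation of the terminals and of words
which satisfy the predicates `S Y` of the nonterminals `Y`. -/
def Yields (S : N → List T → Prop) : List (Symbol T N) → List T → Prop
  | [], w => w = []
  | .terminal a :: s, w => ∃ w', w = a :: w' ∧ Yields S s w'
  | .nonterminal Y :: s, w => ∃ w₁ w₂, w = w₁ ++ w₂ ∧ S Y w₁ ∧ Yields S s w₂

theorem yields_append {S : N → List T → Prop} {s t : List (Symbol T N)} {w : List T} :
    Yields S (s ++ t) w ↔ ∃ w₁ w₂, w = w₁ ++ w₂ ∧ Yields S s w₁ ∧ Yields S t w₂ := by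
  induction s generalizing w with
  | nil => simp [Yields]
  | cons x s ih =>
    cases x with
    | terminal a =>
      simp only [List.cons_append, Yields, ih]
      constructor
      · rintro ⟨_, rfl, w₁, w₂, rfl, h₁, h₂⟩
        exact ⟨a :: w₁, w₂, rfl, ⟨w₁, rfl, h₁⟩, h₂⟩
      · rintro ⟨_, w₂, rfl, ⟨w₁, rfl, h₁⟩, h₂⟩
        exact ⟨_, rfl, w₁, w₂, rfl, h₁, h₂⟩
    | nonterminal Y =>
      simp only [List.cons_append, Yields, ih]
      constructor
      · rintro ⟨w₀, _, rfl, h₀, w₁, w₂, rfl, h₁, h₂⟩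
        exact ⟨w₀ ++ w₁, w₂, (List.append_assoc ..).symm, ⟨w₀, w₁, rfl, h₀, h₁⟩, h₂⟩
      · rintro ⟨_, w₂, rfl, ⟨w₀, w₁, rfl, h₀, h₁⟩, h₂⟩
        exact ⟨w₀, w₁ ++ w₂, List.append_assoc .., h₀, w₁, w₂, rfl, h₁, h₂⟩

theorem yields_map_terminal (S : N → List T → Prop) (w : List T) :
    Yields S (w.map Symbol.terminal) w := by
  induction w with
  | nil => rfl
  | cons a w ih => exact ⟨w, rfl, ih⟩

end Closed

variable {T : Type} {g : ContextFreeGrammar T}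

/-- Predicates closed under the rules of a grammar contain the languages of its nonterminals. -/
theorem of_mem_language {S : g.NT → List T → Prop}
    (hS : ∀ r ∈ g.rules, ∀ w, Yields S r.output w → S r.input w) {w : List T}
    (hw : w ∈ g.language) : S g.initial w := by
  have key : ∀ s, g.Derives s (w.map Symbol.terminal) → Yields S s w := by
    intro s hs
    -- Induction backwards from the terminal word: closure under a rule lets its output be folded
    -- back into its left-hand side.
    induction hs using Relation.ReflTransGen.head_induction_on with
    | refl => exact yields_map_terminal S w
    | head h _ ih =>
      obtain ⟨r, hr, h⟩ := h
      obtain ⟨p, q, rfl, rfl⟩ := h.exists_parts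
      rw [List.append_assoc, yields_append] at ih ⊢
      obtain ⟨w₁, w₂, rfl, h₁, h₂⟩ := ih
      obtain ⟨w₃, w₄, rfl, h₃, h₄⟩ := yields_append.1 h₂
      exact ⟨w₁, _, rfl, h₁, w₃, w₄, rfl, hS r hr _ h₃, h₄⟩
  obtain ⟨w₁, w₂, rfl, h₁, h₂⟩ := key _ hw
  rw [show w₂ = [] from h₂, List.append_nil]
  exact h₁

/-! ### Parikh images -/

open Classical in
/-- Applying every rule `p` of the grammar `n p` times turns a list of symbols with the letter counts
of `s` into one with the letter counts `F`. -/
def Balanced (n : g.rules → ℕ) (s : List (Symbol T g.NT)) (F : Symbol T g.NT → ℕ) : Prop :=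
  ∀ x, s.count x + ∑ p, n p * p.1.output.count x =
    F x + ∑ p, n p * List.count x [Symbol.nonterminal p.1.input]

/-- Nonterminals which can be reached from the list `s` by rules `p` with `n p > 0` whose left-hand
sides avoid the set `U`. -/
inductive Reaches (n : g.rules → ℕ) (U : Set g.NT) (s : List (Symbol T g.NT)) : g.NT → Prop
  | base {Y : g.NT} (h : Symbol.nonterminal Y ∈ s) : Reaches n U s Y
  | step {Y : g.NT} (p : g.rules) (hp : 0 < n p) (hU : p.1.input ∉ U)
      (h : Reaches n U s p.1.input) (hY : Symbol.nonterminal Y ∈ p.1.output) : Reaches n U s Y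

/-- All the rules `p` with `n p > 0` can be reached from `s`. -/
def Connected (n : g.rules → ℕ) (s : List (Symbol T g.NT)) : Prop :=
  ∀ p, 0 < n p → Reaches n ∅ s p.1.input

theorem Reaches.mono {n n' : g.rules → ℕ} {U U' : Set g.NT} {s s' : List (Symbol T g.NT)}
    {Y : g.NT} (h : Reaches n U s Y)
    (hs : ∀ Z, Symbol.nonterminal Z ∈ s → Reaches n' U' s' Z)
    (hn : ∀ p, 0 < n p → p.1.input ∉ U → 0 < n' p ∧ p.1.input ∉ U') : Reaches n' U' s' Y := by
  induction h with
  | base h => exact hs _ h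
  | step p hp hU _ hY ih => exact .step p (hn p hp hU).1 (hn p hp hU).2 ih hY

theorem sum_add_single {ι : Type} [Fintype ι] [DecidableEq ι] (n : ι → ℕ) (q : ι) (c : ι → ℕ) :
    ∑ p, (n + Pi.single q 1 : ι → ℕ) p * c p = ∑ p, n p * c p + c q := by
  simp only [Pi.add_apply, add_mul, Finset.sum_add_distrib]
  congr 1
  rw [Finset.sum_eq_single q]
  · simp
  · intro p _ hp
    simp [Pi.single_eq_of_ne hp]
  · simp

-- Using `q` once more and having its left-hand side instead of its output in the list change both
-- sides of each balance equation equally.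
open Classical in
theorem balanced_step_iff {n : g.rules → ℕ} {q : g.rules} {a b : List (Symbol T g.NT)}
    {F : Symbol T g.NT → ℕ} :
    Balanced (n + Pi.single q 1) (a ++ [Symbol.nonterminal q.1.input] ++ b) F ↔
      Balanced n (a ++ q.1.output ++ b) F := by
  refine forall_congr' fun x => ?_
  rw [sum_add_single n q, sum_add_single n q]
  simp only [List.count_append]
  omega

open Classical in
theorem pos_add_single {n : g.rules → ℕ} {q p : g.rules} :
    0 < (n + Pi.single q 1 : g.rules → ℕ) p ↔ 0 < n p ∨ p = q := by
  by_cases h : p = q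
  · subst h
    simp
  · simp [h]

open Classical in
/-- Applying the rule `q` keeps the rest of the rules reachable if it keeps the left-hand side of `q`
reachable, or if that is not needed any more. -/
theorem Connected.step {n : g.rules → ℕ} {q : g.rules} {a b : List (Symbol T g.NT)}
    (h : Connected (n + Pi.single q 1) (a ++ [Symbol.nonterminal q.1.input] ++ b))
    (hq : ∀ p, 0 < n p → p.1.input = q.1.input →
      Reaches n ∅ (a ++ q.1.output ++ b) q.1.input) :
    Connected n (a ++ q.1.output ++ b) := by
  -- An old path may use the spent copy of `q`; its successors now lie in the list itself, so only
  -- the left-hand side of `q` can be lost.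
  have key : ∀ Y, Reaches (n + Pi.single q 1) ∅ (a ++ [Symbol.nonterminal q.1.input] ++ b) Y →
      Y = q.1.input ∨ Reaches n ∅ (a ++ q.1.output ++ b) Y := by
    intro Y hY
    induction hY with
    | base hY =>
      simp only [List.mem_append, List.mem_singleton, Symbol.nonterminal.injEq] at hY
      rcases hY with (hY | hY) | hY
      · exact .inr (.base (by simp [hY]))
      · exact .inl hY
      · exact .inr (.base (by simp [hY]))
    | step p hp hU _ hY ih =>
      rcases pos_add_single.1 hp with hp | rfl
      · refine .inr (.step p hp hU ?_ hY)
        exact ih.elim (fun ih => ih ▸ hq p hp ih) id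
      · exact .inr (.base (by simp [hY]))
  intro p hp
  exact (key _ (h p (pos_add_single.2 (.inl hp)))).elim (fun h => h ▸ hq p hp h) id

/-- A reachable nonterminal is reached from the other symbols avoiding `Y`, or from a rule of `Y`
avoiding `Y`. -/
theorem Reaches.cases_avoiding {n : g.rules → ℕ} {a b : List (Symbol T g.NT)} {Y W : g.NT}
    (h : Reaches n ∅ (a ++ [Symbol.nonterminal Y] ++ b) W) :
    W = Y ∨ Reaches n {Y} (a ++ b) W ∨
      ∃ q : g.rules, q.1.input = Y ∧ 0 < n q ∧ Reaches n {Y} q.1.output W := by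
  induction h with
  | base h =>
    simp only [List.mem_append, List.mem_singleton, Symbol.nonterminal.injEq] at h
    rcases h with (h | h) | h
    · exact .inr (.inl (.base (by simp [h])))
    · exact .inl h
    · exact .inr (.inl (.base (by simp [h])))
  | step p hp hU _ hW ih =>
    by_cases hY : p.1.input = Y
    · exact .inr (.inr ⟨p, hY, hp, .base hW⟩)
    · rcases ih with ih | ih | ⟨q, hq, hq', ih⟩
      · exact absurd ih hY
      · exact .inr (.inl (.step p hp hY ih hW))
      · exact .inr (.inr ⟨q, hq, hq', .step p hp hY ih hW⟩)

open Classical in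
/-- A nonterminal of a balanced and connected list has a rule whose application preserves this. -/
theorem exists_connected_step {n : g.rules → ℕ} {a b : List (Symbol T g.NT)} {Y : g.NT}
    {F : Symbol T g.NT → ℕ} (hF : ∀ Y, F (.nonterminal Y) = 0)
    (hb : Balanced n (a ++ [Symbol.nonterminal Y] ++ b) F)
    (hc : Connected n (a ++ [Symbol.nonterminal Y] ++ b)) :
    ∃ (q : g.rules) (n' : g.rules → ℕ), q.1.input = Y ∧ n = n' + Pi.single q 1 ∧
      Connected n' (a ++ q.1.output ++ b) := by
  have split : ∀ q : g.rules, 0 < n q → ∃ n' : g.rules → ℕ, n = n' + Pi.single q 1 := by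
    intro q hq
    refine ⟨Function.update n q (n q - 1), funext fun p => ?_⟩
    by_cases hp : p = q
    · subst hp
      simp only [Pi.add_apply, Function.update_self, Pi.single_eq_same]
      omega
    · simp [hp]
  have hbY := hb (.nonterminal Y)
  rw [hF, zero_add] at hbY
  -- If a used rule of `Y` leads back to `Y` without passing through rules of `Y`, it is applied:
  -- the path back survives the loss of one copy of that rule. Otherwise any used rule of `Y` will
  -- do.
  by_cases hgood : ∃ q : g.rules, q.1.input = Y ∧ 0 < n q ∧ Reaches n {Y} q.1.output Y
  · obtain ⟨q, rfl, hq, hr⟩ := hgood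
    obtain ⟨n', rfl⟩ := split q hq
    refine ⟨q, n', rfl, rfl, hc.step fun _ _ _ => hr.mono (fun Z hZ => .base (by simp [hZ])) ?_⟩
    rintro p hp hU
    rcases pos_add_single.1 hp with hp | rfl
    · exact ⟨hp, id⟩
    · exact absurd rfl hU
  · have hpos : 0 < ∑ p : g.rules, n p * List.count (Symbol.nonterminal Y : Symbol T g.NT) [Symbol.nonterminal p.1.input] := by
      rw [← hbY]
      simp
    obtain ⟨q, -, hne⟩ := Finset.exists_ne_zero_of_sum_ne_zero hpos.ne'
    obtain ⟨hq, hqY⟩ := mul_ne_zero_iff.1 hne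
    clear hne
    have hqY : q.1.input = Y := by
      by_contra h
      exact hqY (by simp [h])
    subst hqY
    obtain ⟨n', rfl⟩ := split q (Nat.pos_of_ne_zero hq)
    refine ⟨q, n', rfl, rfl, hc.step fun p hp hpq => ?_⟩
    by_cases hab : Symbol.nonterminal q.1.input ∈ a ++ b
    · refine .base ?_
      simp only [List.mem_append] at hab ⊢
      tauto
    have hcount : List.count (Symbol.nonterminal q.1.input) (a ++ b) = 0 :=
      List.count_eq_zero.2 hab
    -- Another use of a rule of `Y` remains, so `Y` is consumed at least twice; it occurs only once
    -- in the list, hence some used rule produces it.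
    have hne : ∑ p : g.rules, (n' + Pi.single q 1 : g.rules → ℕ) p *
        p.1.output.count (.nonterminal q.1.input) ≠ 0 := by
      have h₁ : 2 ≤ ∑ p : g.rules, (n' + Pi.single q 1 : g.rules → ℕ) p *
          List.count (Symbol.nonterminal q.1.input : Symbol T g.NT) [Symbol.nonterminal p.1.input] := by
        rw [sum_add_single n' q]
        have := Finset.single_le_sum (f := fun p : g.rules => n' p *
          List.count (Symbol.nonterminal q.1.input : Symbol T g.NT) [Symbol.nonterminal p.1.input])
          (fun _ _ => Nat.zero_le _) (Finset.mem_univ p)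
        simp only [hpq, List.count_singleton_self, mul_one] at this ⊢
        omega
      simp only [List.count_append, List.count_singleton_self] at hbY hcount
      omega
    obtain ⟨p', -, hp'⟩ := Finset.exists_ne_zero_of_sum_ne_zero hne
    obtain ⟨hp', hpY⟩ := mul_ne_zero_iff.1 hp'
    have hpY : Symbol.nonterminal q.1.input ∈ p'.1.output := by
      by_contra h
      exact hpY (List.count_eq_zero.2 h)
    have hp' := Nat.pos_of_ne_zero hp'
    by_cases hpq' : p'.1.input = q.1.input
    · exact absurd ⟨p', hpq', hp', .base hpY⟩ hgood
    -- The producer `p'` of `Y` cannot be reached from a rule of `Y` avoiding `Y`, as that rule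
    -- would satisfy `hgood`. So it is reached from `a ++ b`, and this path survives.
    rcases (hc p' hp').cases_avoiding with h | h | ⟨r, hr, hr', h⟩
    · exact absurd h hpq'
    · refine (Reaches.step p' hp' hpq' h hpY).mono (fun Z hZ => .base ?_) ?_
      · simp only [List.mem_append] at hZ ⊢
        tauto
      · rintro p hp hU
        rcases pos_add_single.1 hp with hp | rfl
        · exact ⟨hp, id⟩
        · exact absurd rfl hU
    · exact absurd ⟨r, hr, hr', .step p' hp' hpq' h hpY⟩ hgood

-- Induction on the total number of rule uses. While uses remain, connectedness provides a
-- nonterminal to expand; when none remain, balance says that the list has the counts `F`.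
open Classical in
theorem exists_derives_of_balanced {n : g.rules → ℕ} {s : List (Symbol T g.NT)}
    {F : Symbol T g.NT → ℕ} (hF : ∀ Y, F (.nonterminal Y) = 0) (hb : Balanced n s F)
    (hc : Connected n s) : ∃ s', g.Derives s s' ∧ ∀ x, s'.count x = F x := by
  induction hm : ∑ p, n p generalizing n s with
  | zero =>
    have hn : ∀ p, n p = 0 := fun p => (Finset.sum_eq_zero_iff.1 hm) p (Finset.mem_univ p)
    exact ⟨s, .refl s, fun x => by simpa [hn] using hb x⟩
  | succ m ih =>
    have hY : ∃ Y, Symbol.nonterminal Y ∈ s := by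
      obtain ⟨p, -, hp⟩ := Finset.exists_ne_zero_of_sum_ne_zero (hm.trans_ne (by omega))
      have := hc p (Nat.pos_of_ne_zero hp)
      generalize p.1.input = Z at this
      induction this with
      | base h => exact ⟨_, h⟩
      | step _ _ _ _ _ ih => exact ih
    obtain ⟨Y, hY⟩ := hY
    obtain ⟨a, b, rfl⟩ := List.append_of_mem hY
    rw [← List.singleton_append, ← List.append_assoc] at hb hc ⊢
    obtain ⟨q, n', rfl, rfl, hc'⟩ := exists_connected_step hF hb hc
    have hsum := sum_add_single n' q fun _ => 1
    simp only [mul_one] at hsum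
    obtain ⟨s', hs', h⟩ := ih (balanced_step_iff.1 hb) hc' (by omega)
    exact ⟨s', Produces.trans_derives ⟨q.1, q.2, q.1.rewrites_of_exists_parts a b⟩ hs', h⟩

-- The rules used in the derivation are counted from its end to its beginning; each newly prepended
-- rule rewrites a symbol of the list, and what its output reaches is reached through it.
open Classical in
theorem exists_balanced_of_derives {s s' : List (Symbol T g.NT)} (h : g.Derives s s') :
    ∃ n : g.rules → ℕ, Balanced n s (fun x => s'.count x) ∧ Connected n s := by
  induction h using Relation.ReflTransGen.head_induction_on with
  | refl => exact ⟨0, fun x => by simp, fun p hp => absurd hp (by simp)⟩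
  | head h _ ih =>
    obtain ⟨r, hr, h⟩ := h
    obtain ⟨a, b, rfl, rfl⟩ := h.exists_parts
    obtain ⟨n, hb, hc⟩ := ih
    let q : g.rules := ⟨r, hr⟩
    have hq : Reaches (n + Pi.single q 1) ∅ (a ++ [Symbol.nonterminal r.input] ++ b) q.1.input :=
      .base (by simp [q])
    refine ⟨n + Pi.single q 1, balanced_step_iff.2 hb, fun p hp => ?_⟩
    rcases pos_add_single.1 hp with hp | rfl
    · refine (hc p hp).mono (fun Z hZ => ?_)
        fun p hp hU => ⟨pos_add_single.2 (.inl hp), hU⟩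
      simp only [List.mem_append] at hZ
      rcases hZ with (hZ | hZ) | hZ
      · exact .base (by simp [hZ])
      · exact .step q (pos_add_single.2 (.inr rfl)) id hq hZ
      · exact .base (by simp [hZ])
    · exact hq

/-- The letter counts of a word with letter counts `f` and without nonterminals. -/
def terminalCount {N : Type} (f : T → ℕ) : Symbol T N → ℕ
  | .terminal a => f a
  | .nonterminal _ => 0

open Classical in
theorem count_map_terminal {N : Type} (w : List T) (x : Symbol T N) :
    (w.map Symbol.terminal).count x = terminalCount (RPDA.parikh w) x := by
  cases x with
  | terminal a =>
    exact List.count_map_of_injective w _ (fun _ _ h => Symbol.terminal.inj h) a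
  | nonterminal Y => exact List.count_eq_zero.2 (by simp)

/-- **Parikh images of context-free languages**: they are described by numbers of applications of the
rules which are balanced and connected. -/
theorem exists_parikh_iff {f : T → ℕ} :
    (∃ w ∈ g.language, f = RPDA.parikh w) ↔
      ∃ n : g.rules → ℕ, Balanced n [Symbol.nonterminal g.initial] (terminalCount f) ∧
        Connected n [Symbol.nonterminal g.initial] := by
  classical
  constructor
  · rintro ⟨w, hw, rfl⟩
    obtain ⟨n, hb, hc⟩ := exists_balanced_of_derives hw
    refine ⟨n, ?_, hc⟩
    convert hb using 1
    exact funext fun x => (count_map_terminal w x).symm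
  · rintro ⟨n, hb, hc⟩
    obtain ⟨s, hs, h⟩ := exists_derives_of_balanced (fun _ => rfl) hb hc
    have hsw : ∃ w : List T, s = w.map Symbol.terminal := by
      have hs' : ∀ Y, Symbol.nonterminal Y ∉ s := fun Y => List.count_eq_zero.1 (h _)
      clear h hs
      induction s with
      | nil => exact ⟨[], rfl⟩
      | cons x s ih =>
        obtain ⟨w, rfl⟩ := ih fun Y hY => hs' Y (List.mem_cons_of_mem _ hY)
        cases x with
        | terminal a => exact ⟨a :: w, rfl⟩
        | nonterminal Y => exact absurd List.mem_cons_self (hs' Y)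
    obtain ⟨w, rfl⟩ := hsw
    refine ⟨w, hs, funext fun a => ?_⟩
    have := h (.terminal a)
    rw [count_map_terminal] at this
    exact this.symm

/-- Connectedness can be witnessed by a distance function. -/
theorem connected_singleton_iff {n : g.rules → ℕ} {S : g.NT} :
    Connected n [Symbol.nonterminal S] ↔
      ∃ d : g.NT → ℕ, ∀ p, 0 < n p → p.1.input = S ∨
        ∃ q : g.rules, 0 < n q ∧ Symbol.nonterminal p.1.input ∈ q.1.output ∧
          d q.1.input < d p.1.input := by
  classical
  constructor
  · intro h
    -- `R k` describes reachability in exactly `k` rule steps; the distance is the least such `k`,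
    -- and the predecessor on a shortest path is strictly closer.
    let R : ℕ → g.NT → Prop := fun k => Nat.rec (fun Y => Y = S) (fun _ R Y =>
      ∃ q : g.rules, 0 < n q ∧ Symbol.nonterminal Y ∈ q.1.output ∧ R q.1.input) k
    have hR : ∀ Y, Reaches n ∅ [Symbol.nonterminal S] Y → ∃ k, R k Y := by
      intro Y hY
      induction hY with
      | base h => exact ⟨0, Symbol.nonterminal.inj (List.mem_singleton.1 h)⟩
      | step p hp _ _ hY ih =>
        obtain ⟨k, hk⟩ := ih
        exact ⟨k + 1, p, hp, hY, hk⟩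
    refine ⟨fun Y => sInf {k | R k Y}, fun p hp => ?_⟩
    have hp : R (sInf {k | R k p.1.input}) p.1.input := Nat.sInf_mem (hR _ (h p hp))
    cases hk : sInf {k | R k p.1.input} with
    | zero => exact .inl (hk ▸ hp :)
    | succ k =>
      rw [hk] at hp
      obtain ⟨q, hq, hpq, hRq⟩ := hp
      refine .inr ⟨q, hq, hpq, ?_⟩
      change _ < sInf {k | R k p.1.input}
      rw [hk]
      exact Nat.lt_succ_of_le (Nat.sInf_le hRq)
  · rintro ⟨d, hd⟩ p hp
    induction hm : d p.1.input using Nat.strong_induction_on generalizing p with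
    | _ m ih =>
      rcases hd p hp with h | ⟨q, hq, hpq, hlt⟩
      · exact .base (by simp [h])
      · exact .step q hq id (ih _ (hm ▸ hlt) q hq rfl) hpq

end ContextFreeGrammar

/-! ### Presburger terms -/

namespace Presburger

variable {α : Type}

/-- The constant `k`. -/
def const (k : ℤ) : presLang.Term α := Term.func (l := 0) (PresFunc.const k) ![]

/-- The sum of a list of terms. -/
def sum : List (presLang.Term α) → presLang.Term α
  | [] => const 0
  | t :: l => Term.func (l := 2) PresFunc.add ![t, sum l]

/-- The formula `t ≤ s`. -/
def le {n : ℕ} (t s : presLang.Term (α ⊕ Fin n)) : presLang.BoundedFormula α n :=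
  BoundedFormula.rel (l := 2) PresRel.le ![t, s]

theorem realize_const (k : ℤ) (v : α → ℤ) : (const k).realize v = k := rfl

theorem realize_sum (l : List (presLang.Term α)) (v : α → ℤ) :
    (sum l).realize v = (l.map fun t => t.realize v).sum := by
  induction l with
  | nil => rfl
  | cons t l ih =>
    rw [List.map_cons, List.sum_cons, ← ih]
    rfl

theorem realize_le {n : ℕ} (t s : presLang.Term (α ⊕ Fin n)) (v : α → ℤ) (xs : Fin n → ℤ) :
    (le t s).Realize v xs ↔ t.realize (Sum.elim v xs) ≤ s.realize (Sum.elim v xs) :=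
  Iff.rfl

theorem size_const (k : ℤ) : termSize presFuncSize (const k : presLang.Term α) =
    1 + k.natAbs.size := by
  simp [const, termSize, presFuncSize]

theorem size_sum_le {l : List (presLang.Term α)} {B : ℕ}
    (h : ∀ t ∈ l, termSize presFuncSize t ≤ B) :
    termSize presFuncSize (sum l) ≤ l.length * (B + 1) + 1 := by
  induction l with
  | nil => simp [sum, size_const]
  | cons t l ih =>
    have h₁ := h t List.mem_cons_self
    have h₂ := ih fun s hs => h s (List.mem_cons_of_mem _ hs)
    have h₃ : termSize presFuncSize (sum (t :: l)) =
        1 + (termSize presFuncSize t + termSize presFuncSize (sum l)) := by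
      simp [sum, termSize, presFuncSize]
    rw [h₃, List.length_cons]
    linarith

theorem size_sum_pair (t s : presLang.Term α) :
    termSize presFuncSize (sum [t, s]) = termSize presFuncSize t + termSize presFuncSize s + 3 := by
  simp [sum, termSize, presFuncSize, size_const]
  omega

theorem size_le {n : ℕ} (t s : presLang.Term (α ⊕ Fin n)) :
    formulaSize presFuncSize presRelSize (le t s) =
      1 + (termSize presFuncSize t + termSize presFuncSize s) := by
  simp [le, formulaSize, presRelSize]

theorem isQF_le {n : ℕ} (t s : presLang.Term (α ⊕ Fin n)) : (le t s).IsQF :=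
  (BoundedFormula.IsAtomic.rel _ _).isQF

theorem isExistential_exs {L : FirstOrder.Language.{0, 0}} {n : ℕ} {φ : L.BoundedFormula α n}
    (h : φ.IsExistential) : BoundedFormula.IsExistential φ.exs := by
  induction n with
  | zero => exact h
  | succ n ih => exact ih h.ex

end Presburger

theorem isQF_iSup {L : FirstOrder.Language.{0, 0}} {α β : Type} [Finite β] {n : ℕ}
    {f : β → L.BoundedFormula α n} (h : ∀ b, (f b).IsQF) : (BoundedFormula.iSup f).IsQF := by
  simp only [BoundedFormula.iSup]
  let _ := Fintype.ofFinite β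
  generalize (Finset.univ : Finset β).toList = l
  induction l with
  | nil => exact BoundedFormula.isQF_bot
  | cons b l ih => exact (h b).sup ih

/-! ### Parikh images of context-free languages in Presburger arithmetic -/

namespace ContextFreeGrammar

open Presburger

variable {T : Type} (g : ContextFreeGrammar T) [Finite g.NT]

/-- The bound variables: the number of applications of each rule and the distance of each
nonterminal. -/
noncomputable abbrev NumVars : ℕ := Nat.card (g.rules ⊕ g.NT)

variable {g} in
/-- The number of applications of a rule. -/
noncomputable def ruleVar (p : g.rules) : presLang.Term (T ⊕ Fin g.NumVars) :=
  Term.var (.inr (Finite.equivFin _ (.inl p)))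

variable {g} in
/-- The distance of a nonterminal. -/
noncomputable def distVar (Y : g.NT) : presLang.Term (T ⊕ Fin g.NumVars) :=
  Term.var (.inr (Finite.equivFin _ (.inr Y)))

variable {g} in
/-- The number of occurrences of a symbol in the word. -/
noncomputable def symbolTerm : Symbol T g.NT → presLang.Term (T ⊕ Fin g.NumVars)
  | .terminal a => Term.var (.inl a)
  | .nonterminal _ => const 0

variable {g} in
/-- The linear combination of the numbers of applications of the rules with coefficients `c`. -/
noncomputable def ruleSum (c : g.rules → ℕ) : presLang.Term (T ⊕ Fin g.NumVars) :=
  sum (Finset.univ.toList.map fun p => sum (List.replicate (c p) (ruleVar p)))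

open Classical in
/-- The formula for the balance of a symbol. -/
noncomputable def balanceFormula (x : Symbol T g.NT) : presLang.BoundedFormula T g.NumVars :=
  Term.bdEqual
    (sum [sum (List.replicate (List.count x [Symbol.nonterminal g.initial]) (const 1)),
      ruleSum fun p => p.1.output.count x])
    (sum [symbolTerm x, ruleSum (fun p => List.count x [Symbol.nonterminal p.1.input])])

open Classical in
/-- The formula for the reachability of a rule. -/
noncomputable def connectedFormula (p : g.rules) : presLang.BoundedFormula T g.NumVars :=
  ((le (ruleVar p) (const 0)).not).imp <|
    if p.1.input = g.initial then ⊤ else BoundedFormula.iSup fun q : g.rules =>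
      if Symbol.nonterminal p.1.input ∈ q.1.output then
        (le (ruleVar q) (const 0)).not ⊓ (le (distVar p.1.input) (distVar q.1.input)).not
      else ⊥

/-- The quantifier-free part of the Presburger formula for the Parikh image. -/
noncomputable def parikhMatrix [Finite T] : presLang.BoundedFormula T g.NumVars :=
  (BoundedFormula.iInf fun i => le (const 0) (Term.var (.inr i))) ⊓
    ((BoundedFormula.iInf fun y : T ⊕ g.NT =>
      g.balanceFormula (y.elim Symbol.terminal Symbol.nonterminal)) ⊓
    BoundedFormula.iInf fun p => g.connectedFormula p)

/-- The existential Presburger formula for the Parikh image of the language of a grammar. -/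
noncomputable def parikhFormula [Finite T] : presLang.Formula T := g.parikhMatrix.exs

theorem isExistential_parikhFormula [Finite T] : BoundedFormula.IsExistential g.parikhFormula := by
  refine isExistential_exs (.of_isQF (.inf (isQF_iInf fun i => isQF_le _ _)
    (.inf (isQF_iInf fun y => (BoundedFormula.IsAtomic.equal _ _).isQF)
      (isQF_iInf fun p => (isQF_le _ _).not.imp ?_))))
  split_ifs
  · exact .top
  · refine isQF_iSup fun q => ?_
    split_ifs
    · exact (isQF_le _ _).not.inf (isQF_le _ _).not
    · exact BoundedFormula.isQF_bot

variable {g}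

theorem realize_ruleSum (c : g.rules → ℕ) (f : T → ℤ) (xs : Fin g.NumVars → ℤ) :
    (ruleSum c).realize (Sum.elim f xs) = ∑ p, xs (Finite.equivFin _ (.inl p)) * c p := by
  rw [ruleSum, realize_sum, List.map_map, Finset.sum_map_toList]
  refine Finset.sum_congr rfl fun p _ => ?_
  simp [realize_sum, ruleVar, mul_comm]

open Classical in
theorem realize_balanceFormula (x : Symbol T g.NT) (f : T → ℕ) (xs : Fin g.NumVars → ℕ) :
    (g.balanceFormula x).Realize (fun a => (f a : ℤ)) (fun i => (xs i : ℤ)) ↔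
      List.count x [Symbol.nonterminal g.initial] +
          ∑ p, xs (Finite.equivFin _ (.inl p)) * p.1.output.count x =
        terminalCount f x +
          ∑ p, xs (Finite.equivFin _ (.inl p)) * List.count x [Symbol.nonterminal p.1.input] := by
  have hx : (symbolTerm x).realize (Sum.elim (fun a => (f a : ℤ)) fun i => (xs i : ℤ)) =
      terminalCount f x := by
    cases x <;> rfl
  rw [balanceFormula, BoundedFormula.realize_bdEqual, ← Nat.cast_inj (R := ℤ)]
  simp [realize_sum, realize_ruleSum, hx, realize_const]

theorem realize_connectedFormula (p : g.rules) (f : T → ℤ) (xs : Fin g.NumVars → ℕ) :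
    (g.connectedFormula p).Realize f (fun i => (xs i : ℤ)) ↔
      (0 < xs (Finite.equivFin _ (.inl p)) → p.1.input = g.initial ∨
        ∃ q : g.rules, 0 < xs (Finite.equivFin _ (.inl q)) ∧
          Symbol.nonterminal p.1.input ∈ q.1.output ∧
          xs (Finite.equivFin _ (.inr q.1.input)) < xs (Finite.equivFin _ (.inr p.1.input))) := by
  rw [connectedFormula, BoundedFormula.realize_imp, BoundedFormula.realize_not, realize_le]
  refine imp_congr (by simp [ruleVar, realize_const]) ?_
  split_ifs with h
  · simp [h]
  · simp only [h, false_or, BoundedFormula.realize_iSup]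
    refine exists_congr fun q => ?_
    split_ifs with hq
    · simp only [BoundedFormula.realize_inf, BoundedFormula.realize_not, realize_le, hq, true_and]
      simp [ruleVar, distVar, realize_const]
    · simp [hq]

theorem realize_parikhFormula [Finite T] (f : T → ℕ) :
    g.parikhFormula.Realize (fun a => (f a : ℤ)) ↔ ∃ w ∈ g.language, f = RPDA.parikh w := by
  rw [exists_parikh_iff, parikhFormula, BoundedFormula.realize_exs]
  simp only [parikhMatrix, BoundedFormula.realize_inf, BoundedFormula.realize_iInf, realize_le,
    connected_singleton_iff]
  constructor
  · rintro ⟨xs, h₀, h₁, h₂⟩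
    -- The quantifiers range over `ℤ`; the first conjunct of the matrix makes the witnesses natural
    -- numbers.
    lift xs to Fin g.NumVars → ℕ using h₀
    refine ⟨fun p => xs (Finite.equivFin _ (.inl p)), fun x => ?_,
      fun Y => xs (Finite.equivFin _ (.inr Y)), fun p => (realize_connectedFormula p _ _).1 (h₂ p)⟩
    refine (realize_balanceFormula x _ _).1 ?_
    cases x with
    | terminal a => exact h₁ (.inl a)
    | nonterminal Y => exact h₁ (.inr Y)
  · rintro ⟨n, hb, d, hd⟩
    refine ⟨fun i => ((Sum.elim n d ((Finite.equivFin _).symm i) : ℕ) : ℤ),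
      fun i => Nat.cast_nonneg _, fun y => ?_, fun p => ?_⟩
    · rw [realize_balanceFormula]
      simpa using hb (y.elim Symbol.terminal Symbol.nonterminal)
    · rw [realize_connectedFormula]
      simpa using hd p

/-! ### The size of the formula -/

/-- Coefficients are written as repeated addition, hence in unary. This is harmless because they
count occurrences in lists of length at most two. -/
theorem size_ruleSum_le {c : g.rules → ℕ} {B : ℕ} (hc : ∀ p, c p ≤ B) :
    termSize presFuncSize (ruleSum c) ≤ Nat.card g.rules * (2 * B + 2) + 1 := by
  have h := size_sum_le (l := Finset.univ.toList.map fun p =>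
    sum (List.replicate (c p) (ruleVar p))) (B := 2 * B + 1) (by
      intro t ht
      obtain ⟨p, -, rfl⟩ := List.mem_map.1 ht
      refine (size_sum_le (B := 1) fun s hs => ?_).trans ?_
      · rw [List.eq_of_mem_replicate hs]
        exact le_rfl
      · rw [List.length_replicate]
        have := hc p
        omega)
  rwa [List.length_map, Finset.length_toList, Finset.card_univ,
    ← Nat.card_eq_fintype_card] at h

theorem size_balanceFormula_le (hg : ∀ r ∈ g.rules, r.output.length ≤ 2) (x : Symbol T g.NT) :
    formulaSize presFuncSize presRelSize (g.balanceFormula x) ≤ 10 * Nat.card g.rules + 14 := by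
  classical
  have h₁ := size_ruleSum_le (g := g) (c := fun p => p.1.output.count x) (B := 2)
    fun p => List.count_le_length.trans (hg p.1 p.2)
  have h₂ := size_ruleSum_le (g := g)
    (c := fun p => List.count x [Symbol.nonterminal p.1.input]) (B := 1)
    fun p => List.count_le_length
  have h₃ : termSize presFuncSize (symbolTerm x : presLang.Term (T ⊕ Fin g.NumVars)) ≤ 1 := by
    cases x
    · exact le_rfl
    · simp [symbolTerm, size_const]
  have h₄ := size_sum_le (α := T ⊕ Fin g.NumVars)
    (l := List.replicate (List.count x [Symbol.nonterminal g.initial]) (const 1)) (B := 2) (by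
      intro t ht
      rw [List.eq_of_mem_replicate ht, size_const]
      simp)
  have h₅ : List.count x [Symbol.nonterminal g.initial] ≤ 1 := List.count_le_length
  rw [List.length_replicate] at h₄
  simp only [balanceFormula, Term.bdEqual, formulaSize, size_sum_pair]
  omega

theorem size_connectedFormula_le (p : g.rules) :
    formulaSize presFuncSize presRelSize (g.connectedFormula p) ≤ 18 * Nat.card g.rules + 9 := by
  have h₀ : ∀ q : g.rules, formulaSize presFuncSize presRelSize
      (le (ruleVar q) (const 0)).not = 5 := by
    intro q
    simp [formulaSize_not, size_le, ruleVar, termSize, size_const]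
  have h₁ : ∀ Y Z : g.NT, formulaSize presFuncSize presRelSize
      (le (distVar Y) (distVar Z)).not = 5 := by
    intro Y Z
    simp [formulaSize_not, size_le, distVar, termSize]
  rw [connectedFormula, formulaSize, h₀]
  split_ifs
  · rw [formulaSize_top]
    omega
  -- 15 is the size of the conjunction of two negated inequalities, of size 5 each.
  · refine (Nat.add_le_add_left (formulaSize_iSup_le _ _ (B := 15) fun q => ?_) _).trans (by omega)
    split_ifs
    · rw [formulaSize_inf, h₀, h₁]
    · exact (by decide : (1 : ℕ) ≤ 15)

theorem presSize_parikhFormula_le [Finite T] (hg : ∀ r ∈ g.rules, r.output.length ≤ 2) :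
    presSize g.parikhFormula ≤
      40 * (Nat.card T + Nat.card g.NT + Nat.card g.rules + 1) ^ 2 := by
  rw [presSize, parikhFormula, formulaSize_exs, parikhMatrix, formulaSize_inf, formulaSize_inf]
  have h₁ := formulaSize_iInf_le presFuncSize presRelSize
    (f := fun i : Fin g.NumVars => (le (const 0) (Term.var (.inr i)) :
      presLang.BoundedFormula T g.NumVars))
    (B := 3) fun i => by simp [size_le, termSize, size_const]
  have h₂ := formulaSize_iInf_le presFuncSize presRelSize
    (f := fun y : T ⊕ g.NT => g.balanceFormula (y.elim Symbol.terminal Symbol.nonterminal))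
    fun y => size_balanceFormula_le hg _
  have h₃ := formulaSize_iInf_le presFuncSize presRelSize
    (f := fun p => g.connectedFormula p) size_connectedFormula_le
  rw [Nat.card_sum] at h₂
  rw [Nat.card_fin] at h₁
  have hn : g.NumVars = Nat.card g.rules + Nat.card g.NT := Nat.card_sum
  replace h₁ := h₁.trans (Nat.add_le_add_right (Nat.mul_le_mul_right _ hn.le) _)
  refine (Nat.add_le_add (Nat.add_le_add_right (Nat.add_le_add h₁
    (Nat.add_le_add_right (Nat.add_le_add h₂ h₃) 5)) 5)
    (Nat.mul_le_mul_left 5 hn.le)).trans ?_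
  nlinarith [Nat.zero_le (Nat.card T * Nat.card g.rules), Nat.zero_le (Nat.card T * Nat.card g.NT)]

end ContextFreeGrammar

namespace RPDA

variable {A Γ L X Z : Type}

/-! ### Runs -/

theorem Run.append {Q : RPDA A Γ L X Z} {c₁ c₂ c₃ : Config Γ L X Z} {w w' : List (Option A)}
    (h : Q.Run c₁ w c₂) (h' : Q.Run c₂ w' c₃) : Q.Run c₁ (w ++ w') c₃ := by
  induction h with
  | nil => exact h'
  | cons h _ ih => exact .cons h (ih h')

theorem Run.single {Q : RPDA A Γ L X Z} {c₁ c₂ : Config Γ L X Z} {a : Option A}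
    (h : Q.Step c₁ a c₂) : Q.Run c₁ [a] c₂ :=
  .cons h (.nil _)

theorem Step.append_stack {Q : RPDA A Γ L X Z} {c₁ c₂ : Config Γ L X Z} {a : Option A}
    (h : Q.Step c₁ a c₂) (u : List (Γ × (Z → Atom))) :
    Q.Step (c₁.1, c₁.2.1, c₁.2.2 ++ u) a (c₂.1, c₂.2.1, c₂.2.2 ++ u) := by
  cases h with
  | input μ _ h => exact .input μ _ h
  | test μ ν _ h hφ => exact .test μ ν _ h hφ
  | push μ μ₁ _ h hψ => exact .push μ μ₁ _ h hψ
  | pop μ μ₁ _ h hψ => exact .pop μ μ₁ _ h hψ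

theorem Run.append_stack {Q : RPDA A Γ L X Z} {c₁ c₂ : Config Γ L X Z} {w : List (Option A)}
    (h : Q.Run c₁ w c₂) (u : List (Γ × (Z → Atom))) :
    Q.Run (c₁.1, c₁.2.1, c₁.2.2 ++ u) w (c₂.1, c₂.2.1, c₂.2.2 ++ u) := by
  induction h with
  | nil => exact .nil _
  | cons h _ ih => exact .cons (h.append_stack u) ih

/-- The action of a permutation of the atoms on configurations. -/
def Config.map (α : Equiv.Perm Atom) (c : Config Γ L X Z) : Config Γ L X Z :=
  (c.1, fun x => α (c.2.1 x), c.2.2.map fun s => (s.1, fun z => α (s.2 z)))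

theorem KConstraint.realize_elim_aut {V W : Type} (φ : KConstraint (V ⊕ W))
    {α : Equiv.Perm Atom} (hα : IsCycAut α) {μ : V → Atom} {ν : W → Atom}
    (h : φ.1.Realize (Sum.elim μ ν)) :
    φ.1.Realize (Sum.elim (fun i => α (μ i)) fun i => α (ν i)) := by
  rw [← cycLang_realize_aut φ.2 hα] at h
  convert h using 1
  funext i
  cases i <;> rfl

theorem Step.map {Q : RPDA A Γ L X Z} {c₁ c₂ : Config Γ L X Z} {a : Option A}
    (h : Q.Step c₁ a c₂) {α : Equiv.Perm Atom} (hα : IsCycAut α) :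
    Q.Step (c₁.map α) a (c₂.map α) := by
  cases h with
  | input μ _ h => exact .input _ _ h
  | test μ ν _ h hφ => exact .test _ _ _ h (KConstraint.realize_elim_aut _ hα hφ)
  | push μ μ₁ _ h hψ => exact .push _ _ _ h (KConstraint.realize_elim_aut _ hα hψ)
  | pop μ μ₁ _ h hψ => exact .pop _ _ _ h (KConstraint.realize_elim_aut _ hα hψ)

theorem Run.map {Q : RPDA A Γ L X Z} {c₁ c₂ : Config Γ L X Z} {w : List (Option A)}
    (h : Q.Run c₁ w c₂) {α : Equiv.Perm Atom} (hα : IsCycAut α) :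
    Q.Run (c₁.map α) w (c₂.map α) := by
  induction h with
  | nil => exact .nil _
  | cons h _ ih => exact .cons (h.map hα) ih

/-- Reachability depends only on the orbit of the pair of valuations. -/
theorem ReachWord.congr {Q : RPDA A Γ L X Z} {l r : L} {μ ν μ' ν' : X → Atom}
    {w : List (Option A)} (h : Q.ReachWord l r μ w ν)
    (ho : orbitOf (Sum.elim μ ν) = orbitOf (Sum.elim μ' ν')) : Q.ReachWord l r μ' w ν' := by
  obtain ⟨α, hα, hv⟩ := orbitOf_eq_iff.1 ho
  have hμ : (fun x => α (μ x)) = μ' := funext fun x => hv (.inl x)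
  have hν : (fun x => α (ν x)) = ν' := funext fun x => hv (.inr x)
  rw [← hμ, ← hν]
  exact Run.map h hα

/-! ### Soundness of the grammar -/

/-- The words of runs between valuations in the orbit of the nonterminal. -/
def RunWord (Q : RPDA A Γ L X Z) (N : NT L X) (w : List A) : Prop :=
  ∃ (u : List (Option A)) (μ ν : X → Atom), u.reduceOption = w ∧
    orbitOf (Sum.elim μ ν) = N.2.2 ∧ Q.ReachWord N.1 N.2.1 μ u ν

theorem orbit_proj_mk {V W : Type} (f : W → V) (v : V → Atom) :
    Orbit.proj f (orbitOf v) = orbitOf (v ∘ f) := rfl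

/-- The runs given for the nonterminals on the right end in unrelated valuations of the right
orbits. `ReachWord.congr` moves them to the components of one representative `v` of the orbit of
triples, where they fit together. -/
theorem RunWord.of_production {Q : RPDA A Γ L X Z} {N : NT L X} {s : List (Symbol A (NT L X))}
    {w : List A} (h : Q.Production N s) (hw : ContextFreeGrammar.Yields Q.RunWord s w) :
    Q.RunWord N w := by
  cases h with
  | empty l ho =>
    obtain rfl : w = [] := hw
    obtain ⟨μ, hμ⟩ := ho
    exact ⟨[], μ, μ, rfl, hμ, .nil _⟩
  | @input l r a o h ho =>
    obtain ⟨μ, hμ⟩ := ho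
    refine ⟨[a], μ, μ, ?_, hμ, .single (.input μ [] h)⟩
    cases a with
    | none =>
      obtain rfl : w = [] := hw
      rfl
    | some a =>
      obtain ⟨w', rfl, hw'⟩ := hw
      obtain rfl : w' = [] := hw'
      rfl
  | test h ho =>
    obtain rfl : w = [] := hw
    obtain ⟨v, hv, hφ⟩ := ho
    refine ⟨[none], v ∘ .inl, v ∘ .inr, rfl, ?_, .single (.test _ _ [] h ?_)⟩
    · rwa [Sum.elim_comp_inl_inr]
    · rwa [Sum.elim_comp_inl_inr]
  | trans l m r o =>
    obtain ⟨w₁, _, rfl, ⟨u₁, μ₁, ν₁, rfl, ho₁, h₁⟩, w₂, _, rfl, ⟨u₂, μ₂, ν₂, rfl, ho₂, h₂⟩, rfl⟩ := hw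
    obtain ⟨v, rfl⟩ : ∃ v, orbitOf v = o := ⟨_, Quotient.out_eq o⟩
    have h₁ := h₁.congr (μ' := v ∘ .inl ∘ .inl) (ν' := v ∘ .inl ∘ .inr) (ho₁.trans (congrArg _
      (funext fun i => by cases i <;> rfl)))
    have h₂ := h₂.congr (μ' := v ∘ .inl ∘ .inr) (ν' := v ∘ .inr) (ho₂.trans (congrArg _
      (funext fun i => by cases i <;> rfl)))
    refine ⟨u₁ ++ u₂, _, _, ?_, congrArg _ (funext fun i => ?_), Run.append h₁ h₂⟩
    · simp [List.reduceOption_append]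
    · cases i <;> rfl
  | @pushPop l l' r' r γ φ ψ o h h' ho ho' =>
    obtain ⟨w₁, _, rfl, ⟨u, μ, ν, rfl, ho₁, h₁⟩, rfl⟩ := hw
    obtain ⟨v, rfl⟩ : ∃ v, orbitOf v = o := ⟨_, Quotient.out_eq o⟩
    have h₁ := h₁.congr (μ' := v ∘ .inl ∘ .inl) (ν' := v ∘ .inl ∘ .inr) (ho₁.trans (congrArg _
      (funext fun i => by cases i <;> rfl)))
    have hφ : φ.1.Realize (Sum.elim (v ∘ .inl ∘ .inl) (v ∘ .inr)) := by
      convert Orbit.sat_orbitOf.1 ho using 1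
      exact funext fun i => by cases i <;> rfl
    have hψ : ψ.1.Realize (Sum.elim (v ∘ .inl ∘ .inr) (v ∘ .inr)) := by
      convert Orbit.sat_orbitOf.1 ho' using 1
      exact funext fun i => by cases i <;> rfl
    refine ⟨none :: (u ++ [none]), _, _, ?_, congrArg _ (funext fun i => ?_),
      .cons (.push _ (v ∘ .inr) [] h hφ) (Run.append (Run.append_stack h₁ _)
        (.single (.pop _ (v ∘ .inr) [] h' hψ)))⟩
    · simp [List.reduceOption_append]
    · cases i <;> rfl

theorem Production.length_le {Q : RPDA A Γ L X Z} {N : NT L X} {s : List (Symbol A (NT L X))}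
    (h : Q.Production N s) : s.length ≤ 2 := by
  cases h with
  | @input l r a o h ho => cases a <;> simp
  | _ => simp

/-! ### Completeness of the grammar -/

section Complete

variable [Finite A] [Finite L] [Finite X] {Q : RPDA A Γ L X Z}

theorem mem_rules_iff {l₀ r₀ : L} {o₀ : Orbit (X ⊕ X)} {N : NT L X}
    {s : List (Symbol A (NT L X))} :
    (⟨N, s⟩ : ContextFreeRule A (NT L X)) ∈ (Q.grammar l₀ r₀ o₀).rules ↔ Q.Production N s :=
  Q.finite_productions.mem_toFinset

/-- The rules do not depend on the start symbol, so derivations transfer freely between the grammars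
of different nonterminals; `Generates.trans` relies on this. -/
theorem derives_of_production {N : NT L X} {s : List (Symbol A (NT L X))} (l₀ r₀ : L)
    (o₀ : Orbit (X ⊕ X)) (h : Q.Production N s) :
    (Q.grammar l₀ r₀ o₀).Derives [Symbol.nonterminal N] s :=
  ContextFreeGrammar.Produces.single ⟨⟨N, s⟩, mem_rules_iff.2 h,
    ContextFreeRule.Rewrites.input_output⟩

/-- The grammar derives the word from the nonterminal of the orbit of the pair of valuations. -/
def Generates (Q : RPDA A Γ L X Z) (l : L) (μ : X → Atom) (w : List A) (r : L) (ν : X → Atom) :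
    Prop :=
  w ∈ (Q.grammar l r (orbitOf (Sum.elim μ ν))).language

theorem Generates.trans {l m r : L} {μ ρ ν : X → Atom} {w₁ w₂ : List A}
    (h₁ : Q.Generates l μ w₁ m ρ) (h₂ : Q.Generates m ρ w₂ r ν) :
    Q.Generates l μ (w₁ ++ w₂) r ν := by
  have hp := Production.trans (Q := Q) l m r (orbitOf (Sum.elim (Sum.elim μ ρ) ν))
  simp only [orbit_proj_mk] at hp
  rw [show Sum.elim (Sum.elim μ ρ) ν ∘ Sum.map Sum.inl id = Sum.elim μ ν from
      funext fun i => by cases i <;> rfl,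
    show Sum.elim (Sum.elim μ ρ) ν ∘ Sum.map Sum.inr id = Sum.elim ρ ν from
      funext fun i => by cases i <;> rfl, Sum.elim_comp_inl] at hp
  refine (derives_of_production l r _ hp).trans ?_
  rw [List.map_append]
  exact (ContextFreeGrammar.Derives.append_right h₁ [_]).trans
    (ContextFreeGrammar.Derives.append_left h₂ _)

theorem Generates.pushPop {l l' r' r : L} {μ ν : X → Atom} {μ₁ : Z → Atom} {w : List A} {γ : Γ}
    {φ ψ : KConstraint (X ⊕ Z)} (h : Q.Generates l' μ w r' ν)
    (hl : (l, Op.push γ φ, l') ∈ Q.Δ) (hφ : φ.1.Realize (Sum.elim μ μ₁))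
    (hr : (r', Op.pop γ ψ, r) ∈ Q.Δ) (hψ : ψ.1.Realize (Sum.elim ν μ₁)) :
    Q.Generates l μ w r ν := by
  have hp := Production.pushPop (Q := Q) (orbitOf (Sum.elim (Sum.elim μ ν) μ₁)) hl hr
    (Orbit.sat_orbitOf.2 (by
      convert hφ using 1
      exact funext fun i => by cases i <;> rfl))
    (Orbit.sat_orbitOf.2 (by
      convert hψ using 1
      exact funext fun i => by cases i <;> rfl))
  rw [orbit_proj_mk, Sum.elim_comp_inl] at hp
  exact (derives_of_production l r _ hp).trans h

theorem Generates.refl (l : L) (μ : X → Atom) : Q.Generates l μ [] l μ :=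
  derives_of_production _ _ _ (.empty l ⟨μ, rfl⟩)

/-- Runs from the stack `u` to the empty stack, decomposed into parts generated by the grammar and
the rules which pop the elements of `u`. -/
def GeneratesFrom (Q : RPDA A Γ L X Z) (r : L) (ν : X → Atom) :
    L → (X → Atom) → List (Γ × (Z → Atom)) → List A → Prop
  | l, μ, [], w => Q.Generates l μ w r ν
  | l, μ, s :: u, w => ∃ (l₁ l₂ : L) (ρ : X → Atom) (w₁ w₂ : List A) (ψ : KConstraint (X ⊕ Z)),
      w = w₁ ++ w₂ ∧ Q.Generates l μ w₁ l₁ ρ ∧ (l₁, Op.pop s.1 ψ, l₂) ∈ Q.Δ ∧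
        ψ.1.Realize (Sum.elim ρ s.2) ∧ GeneratesFrom Q r ν l₂ ρ u w₂

/-- A balanced prefix is absorbed into the first balanced segment. -/
theorem GeneratesFrom.cons {l l' r : L} {μ μ' ν : X → Atom} {u : List (Γ × (Z → Atom))}
    {w w' : List A} (h : Q.Generates l μ w l' μ') (h' : Q.GeneratesFrom r ν l' μ' u w') :
    Q.GeneratesFrom r ν l μ u (w ++ w') := by
  cases u with
  | nil => exact h.trans h'
  | cons s u =>
    obtain ⟨l₁, l₂, ρ, w₁, w₂, ψ, rfl, h₁, h₂, h₃, h₄⟩ := h'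
    exact ⟨l₁, l₂, ρ, w ++ w₁, w₂, ψ, (List.append_assoc ..).symm, h.trans h₁, h₂, h₃, h₄⟩

/-- Induction on the run needs arbitrary initial stacks, as its suffixes start with nonempty ones.
-/
theorem Run.generatesFrom {c c' : Config Γ L X Z} {w : List (Option A)} (h : Q.Run c w c')
    (hc' : c'.2.2 = []) :
    Q.GeneratesFrom c'.1 c'.2.1 c.1 c.2.1 c.2.2 w.reduceOption := by
  induction h with
  | nil c =>
    rw [hc']
    exact Generates.refl _ _
  | @cons c c₁ c' a w h _ ih =>
    have ih := ih hc'
    cases h with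
    | @input l r a μ u h =>
      have := GeneratesFrom.cons (w := a.toList) (l := l) (μ := μ) (by
        have := derives_of_production l r (orbitOf (Sum.elim μ μ)) (Production.input h ⟨μ, rfl⟩)
        cases a <;> exact this) ih
      cases a <;> exact this
    | @test l r φ μ ν u h hφ =>
      exact GeneratesFrom.cons (w := []) (derives_of_production l r _
        (.test h (Orbit.sat_orbitOf.2 hφ))) ih
    | @push l r γ ψ μ μ₁ u h hψ =>
      -- The decomposition of the rest of the run exhibits the pop matching this push; the pair
      -- becomes a push-pop production around the segment in between.
      obtain ⟨l₁, l₂, ρ, w₁, w₂, ψ', hw, h₁, h₂, h₃, h₄⟩ := ih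
      change GeneratesFrom Q _ _ _ _ _ w.reduceOption
      rw [hw]
      exact GeneratesFrom.cons (h₁.pushPop h hψ h₂ h₃) h₄
    | @pop l r γ ψ μ μ₁ u h hψ =>
      exact ⟨l, r, μ, [], _, ψ, rfl, .refl _ _, h, hψ, ih⟩

/-- The language of the nonterminal `X_{l r o}`. -/
theorem mem_language_grammar_iff (l r : L) (o : Orbit (X ⊕ X)) (w : List A) :
    w ∈ (Q.grammar l r o).language ↔ ∃ (u : List (Option A)) (μ ν : X → Atom),
      u.reduceOption = w ∧ orbitOf (Sum.elim μ ν) = o ∧ Q.ReachWord l r μ u ν := by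
  constructor
  · exact ContextFreeGrammar.of_mem_language (g := Q.grammar l r o) (S := Q.RunWord)
      fun p hp w hw => RunWord.of_production (mem_rules_iff.1 hp) hw
  · rintro ⟨u, μ, ν, rfl, rfl, h⟩
    exact Run.generatesFrom h rfl

/-- A word of the language comes from some pair in the orbit; invariance moves its run to the given
pair. -/
theorem reach_iff {l r : L} {μ ν : X → Atom} {f : A → ℕ} :
    Q.Reach l r μ f ν ↔
      ∃ w ∈ (Q.grammar l r (orbitOf (Sum.elim μ ν))).language, f = parikh w := by
  simp only [mem_language_grammar_iff]
  constructor
  · rintro ⟨u, hu, rfl⟩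
    exact ⟨_, ⟨u, μ, ν, rfl, rfl, hu⟩, rfl⟩
  · rintro ⟨_, ⟨u, μ', ν', rfl, ho, hu⟩, rfl⟩
    exact ⟨u, hu.congr ho, rfl⟩

end Complete

/-! ### Disjunctions over orbits -/

theorem realize_iOr {V β : Type} [Finite β] (F : β → HybridFormula A V) (f : A → ℤ)
    (v : V → Atom) : (HybridFormula.iOr F).Realize f v ↔ ∃ b, (F b).Realize f v := by
  simp only [HybridFormula.iOr]
  let _ := Fintype.ofFinite β
  have key : ∀ l : List β, ((l.map F).foldr HybridFormula.or HybridFormula.bot).Realize f v ↔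
      ∃ b ∈ l, (F b).Realize f v := by
    intro l
    induction l with
    | nil => simp [HybridFormula.Realize]
    | cons b l ih => simp [HybridFormula.Realize, ih]
  rw [key]
  simp

theorem size_iOr_le {V β : Type} [Finite β] {F : β → HybridFormula A V} {B : ℕ}
    (h : ∀ b, (F b).size ≤ B) : (HybridFormula.iOr F).size ≤ Nat.card β * (B + 1) + 1 := by
  simp only [HybridFormula.iOr]
  let _ := Fintype.ofFinite β
  rw [Nat.card_eq_fintype_card, ← Finset.card_univ, ← Finset.length_toList]
  generalize (Finset.univ : Finset β).toList = l
  induction l with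
  | nil => simp [HybridFormula.size]
  | cons b l ih =>
    simp only [List.map_cons, List.foldr_cons, HybridFormula.size, List.length_cons]
    have := h b
    linarith

end RPDA

/-! ### Counting rules and nonterminals, and the size of the final formula. -/

theorem ContextFreeGrammar.card_rules_le {T : Type} [Finite T] (g : ContextFreeGrammar T)
    [Finite g.NT] (hg : ∀ r ∈ g.rules, r.output.length ≤ 2) :
    Nat.card g.rules ≤ Nat.card g.NT * (Nat.card T + Nat.card g.NT + 1) ^ 2 := by
  let e : Symbol T g.NT → T ⊕ g.NT
    | .terminal a => .inl a
    | .nonterminal Y => .inr Y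
  have he : e.Injective := by
    rintro (a | a) (b | b) h
    · exact congrArg _ (Sum.inl.inj h)
    · exact absurd h Sum.inl_ne_inr
    · exact absurd h Sum.inr_ne_inl
    · exact congrArg _ (Sum.inr.inj h)
  -- A right-hand side of length at most two is determined by its first two optional entries.
  let F : g.rules → g.NT × Option (T ⊕ g.NT) × Option (T ⊕ g.NT) := fun r =>
    (r.1.input, r.1.output[0]?.map e, r.1.output[1]?.map e)
  have hF : F.Injective := by
    rintro ⟨r, hr⟩ ⟨r', hr'⟩ h
    obtain ⟨h₁, h₂⟩ := Prod.ext_iff.1 h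
    obtain ⟨h₂, h₃⟩ := Prod.ext_iff.1 h₂
    refine Subtype.ext (ContextFreeRule.ext h₁ (List.ext_getElem? fun i => ?_))
    match i with
    | 0 => exact Option.map_injective he h₂
    | 1 => exact Option.map_injective he h₃
    | i + 2 =>
      have h₄ := hg r hr
      have h₅ := hg r' hr'
      rw [List.getElem?_eq_none (h₄.trans (Nat.le_add_left 2 i)),
        List.getElem?_eq_none (h₅.trans (Nat.le_add_left 2 i))]
  refine (Nat.card_le_card_of_injective F hF).trans (le_of_eq ?_)
  simp only [Nat.card_prod, Finite.card_option, Nat.card_sum, sq]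

namespace RPDA

variable {A Γ L X Z : Type}

instance [Finite A] [Finite L] [Finite X] (Q : RPDA A Γ L X Z) (l r : L) (o : Orbit (X ⊕ X)) :
    Finite (Q.grammar l r o).NT :=
  inferInstanceAs (Finite (NT L X))

theorem card_NT_add_le [Fintype A] [Fintype Γ] [Fintype L] [Fintype X] [Fintype Z]
    (Q : RPDA A Γ L X Z) :
    Nat.card A + Nat.card (NT L X) + 1 ≤ 2 ^ (4 * Q.size ^ 2 + 5 * Q.size + 1) ∧
      Nat.card (Orbit (X ⊕ X)) ≤ 2 ^ (4 * Q.size ^ 2 + 5 * Q.size + 1) ∧ Nat.card X ≤ Q.size := by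
  have hA : Nat.card A ≤ Q.size := by rw [Nat.card_eq_fintype_card, size]; omega
  have hL : Nat.card L ≤ Q.size := by rw [Nat.card_eq_fintype_card, size]; omega
  have hX : Nat.card X ≤ Q.size := by rw [Nat.card_eq_fintype_card, size]; omega
  generalize Q.size = s at hA hL hX
  have hs : s + 1 ≤ 2 ^ s := Nat.lt_two_pow_self
  -- A pair of valuations has at most `2 * s` entries; the two locations and the alphabet then add
  -- to the exponent.
  have hO : Nat.card (Orbit (X ⊕ X)) ≤ 2 ^ (4 * s ^ 2 + 2 * s) := by
    refine (card_orbit_le _).trans (Nat.pow_le_pow_right two_pos ?_)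
    rw [Nat.card_sum]
    nlinarith
  have hN : Nat.card (NT L X) ≤ 2 ^ (4 * s ^ 2 + 4 * s) := by
    rw [Nat.card_prod, Nat.card_prod]
    calc Nat.card L * (Nat.card L * Nat.card (Orbit (X ⊕ X)))
        ≤ 2 ^ s * (2 ^ s * 2 ^ (4 * s ^ 2 + 2 * s)) := by
          gcongr <;> omega
      _ = 2 ^ (4 * s ^ 2 + 4 * s) := by
          rw [← pow_add, ← pow_add]
          congr 1
          omega
  refine ⟨?_, hO.trans (Nat.pow_le_pow_right two_pos (by omega)), hX⟩
  calc Nat.card A + Nat.card (NT L X) + 1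
      ≤ 2 ^ s + 2 ^ (4 * s ^ 2 + 4 * s) := by omega
    _ ≤ 2 ^ (4 * s ^ 2 + 5 * s) + 2 ^ (4 * s ^ 2 + 5 * s) := by
        gcongr <;> omega
    _ = 2 ^ (4 * s ^ 2 + 5 * s + 1) := by ring

theorem size_reachFormula_le [Fintype A] [Fintype Γ] [Fintype L] [Fintype X] [Fintype Z]
    (Q : RPDA A Γ L X Z) (l r : L) :
    (reachFormula fun o => (Q.grammar l r o).parikhFormula).size ≤
      2 ^ (28 * Q.size ^ 2 + 35 * Q.size + 18) := by
  obtain ⟨hM, hO, hX⟩ := Q.card_NT_add_le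
  have hpres : ∀ o, presSize (Q.grammar l r o).parikhFormula ≤
      40 * (2 * (Nat.card A + Nat.card (NT L X) + 1) ^ 3) ^ 2 := by
    intro o
    have hg : ∀ p ∈ (Q.grammar l r o).rules, p.output.length ≤ 2 := fun p hp =>
      (mem_rules_iff.1 hp).length_le
    refine (ContextFreeGrammar.presSize_parikhFormula_le hg).trans ?_
    have hP := (Q.grammar l r o).card_rules_le hg
    change _ ≤ Nat.card (NT L X) * (Nat.card A + Nat.card (NT L X) + 1) ^ 2 at hP
    change 40 * (Nat.card A + Nat.card (NT L X) + _ + 1) ^ 2 ≤ _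
    gcongr
    generalize Nat.card (Q.grammar l r o).rules = P at hP ⊢
    generalize Nat.card (NT L X) = N at hP ⊢
    generalize Nat.card A = a at hP ⊢
    have h₁ : N * (a + N + 1) ^ 2 ≤ (a + N + 1) ^ 3 := by
      rw [pow_succ' _ 2]
      gcongr
      omega
    have h₂ : a + N + 1 ≤ (a + N + 1) ^ 3 := Nat.le_self_pow (by omega) _
    omega
  have hcyc : ∀ o : Orbit (X ⊕ X), cycSize (charConstraint o) ≤ 132 * (Q.size + 1) ^ 3 := by
    intro o
    refine (cycSize_charConstraint_le o).trans ?_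
    rw [Nat.card_sum]
    have h : Nat.card X + Nat.card X ≤ 2 * Q.size := by omega
    calc 11 * ((Nat.card X + Nat.card X) ^ 2 + (Nat.card X + Nat.card X) ^ 3) + 11
        ≤ 11 * ((2 * Q.size) ^ 2 + (2 * Q.size) ^ 3) + 11 := by gcongr
      _ ≤ 132 * (Q.size + 1) ^ 3 := by
        ring_nf
        omega
  refine (size_iOr_le (B := 1 + 40 * (2 * (Nat.card A + Nat.card (NT L X) + 1) ^ 3) ^ 2 +
    132 * (Q.size + 1) ^ 3) fun o => ?_).trans ?_
  · simp only [HybridFormula.size]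
    exact Nat.add_le_add (Nat.add_le_add_left (hpres o) 1) (hcyc o)
  generalize hE : 4 * Q.size ^ 2 + 5 * Q.size + 1 = E at hM hO
  have hs : Q.size + 1 ≤ 2 ^ E :=
    (Nat.lt_two_pow_self (n := Q.size)).trans_le (Nat.pow_le_pow_right two_pos (by omega))
  calc _ ≤ 2 ^ E * (1 + 40 * (2 * (2 ^ E) ^ 3) ^ 2 + 132 * (2 ^ E) ^ 3 + 1) + 1 := by gcongr
    -- With `y = 2 ^ E`, there are at most `y` disjuncts, each dominated by a Presburger part of
    -- order `y ^ 6`; `2 ^ 11` absorbs the coefficients.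
    _ ≤ 2 ^ (7 * E + 11) := by
      have h : 1 ≤ 2 ^ E := Nat.one_le_two_pow
      rw [pow_add, mul_comm 7 E, pow_mul]
      generalize 2 ^ E = y at h
      have h₁ : y ≤ y ^ 7 := Nat.le_self_pow (by omega) _
      have h₂ : y ^ 4 ≤ y ^ 7 := Nat.pow_le_pow_right h (by omega)
      have h₃ : 1 ≤ y ^ 7 := Nat.one_le_pow _ _ h
      ring_nf
      omega
    _ ≤ _ := Nat.pow_le_pow_right two_pos (by omega)

end RPDA

theorem mainTheorem6 :
    ∃ p : Polynomial ℕ, ∀ (A Γ L X Z : Type) [Fintype A] [Fintype Γ] [Fintype L] [Fintype X]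
      [Fintype Z] (Q : RPDA A Γ L X Z),
      -- each characteristic constraint is a `K`-constraint that defines its orbit
      (∀ o : Orbit (X ⊕ X), BoundedFormula.IsQF (charConstraint o) ∧
        ∀ v : X ⊕ X → Atom, (charConstraint o).Realize v ↔ orbitOf v = o) ∧
      -- the language of each nonterminal `X_{l r o}`
      (∀ (l r : L) (o : Orbit (X ⊕ X)) (w : List A), w ∈ (Q.grammar l r o).language ↔
        ∃ (u : List (Option A)) (μ ν : X → Atom), u.reduceOption = w ∧
          orbitOf (Sum.elim μ ν) = o ∧ Q.ReachWord l r μ u ν) ∧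
      ∃ φZ : L → L → Orbit (X ⊕ X) → presLang.Formula A,
        -- existential Presburger formulas for the Parikh images of the nonterminals
        (∀ l r o, BoundedFormula.IsExistential (φZ l r o) ∧
          ∀ f : A → ℕ, (φZ l r o).Realize (fun a => (f a : ℤ)) ↔
            ∃ w ∈ (Q.grammar l r o).language, f = RPDA.parikh w) ∧
        ∀ l r,
          -- the disjunction over the orbits expresses the reachability relation
          (∀ (μ : X → Atom) (f : A → ℕ) (ν : X → Atom),
            (RPDA.reachFormula (φZ l r)).Realize (fun a => (f a : ℤ)) (Sum.elim μ ν) ↔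
              Q.Reach l r μ f ν) ∧
          -- it has size exponential in the automaton
          (RPDA.reachFormula (φZ l r)).size ≤ 2 ^ p.eval Q.size := by
  refine ⟨28 * Polynomial.X ^ 2 + 35 * Polynomial.X + 18, ?_⟩
  intro A Γ L X Z _ _ _ _ _ Q
  refine ⟨fun o => ⟨isQF_charConstraint o, realize_charConstraint o⟩,
    fun l r o w => RPDA.mem_language_grammar_iff l r o w,
    fun l r o => (Q.grammar l r o).parikhFormula,
    fun l r o => ⟨(Q.grammar l r o).isExistential_parikhFormula,
      ContextFreeGrammar.realize_parikhFormula⟩, fun l r => ⟨fun μ f ν => ?_, ?_⟩⟩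
  · simp only [RPDA.reachFormula, RPDA.realize_iOr, HybridFormula.Realize,
      ContextFreeGrammar.realize_parikhFormula, realize_charConstraint, RPDA.reach_iff]
    -- Only the disjunct of the orbit of `(μ, ν)` itself can hold.
    exact ⟨fun ⟨_, h, ho⟩ => ho ▸ h, fun h => ⟨_, h, rfl⟩⟩
  · simpa using Q.size_reachFormula_le l r
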